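/- **Setting.** Let $\nu\ge 1$, let $m_1\le m_2\le\dots\le m_{\nu+1}$, let $t_0<t_1<T$ and $J=[t_1,T]$. For $i=1,\dots,\nu$ let $f_i(t,x_1,\dots,x_{i+1})\in\mathbb R^{m_i}$ be defined for $t\in[t_0,T]$, $x_j\in\mathbb R^{m_j}$, such that (I) $f_i$ and its partial derivatives with respect to $x_1,\dots,x_{i+1}$ are continuous in $(t,x_1,\dots,x_{i+1})$; (II) for all $t\in[t_0,T]$ and $x_1,\dots,x_i$, the map $f_i(t,x_1,\dots,x_i,\cdot)$ is of class $C^{m_{i+1}-m_i+1}$ and maps $\mathbb R^{m_{i+1}}$ onto $\mathbb R^{m_i}$. Let $x_j^*\in\mathbb R^{m_j}$ ($j=1,\dots,\nu+1$) and $z_i^*\in\mathbb R^{m_i}$ satisfy $z_i^*=f_i(t_1,x_1^*,\dots,x_{i+1}^*)$ and $\operatorname{rank}\frac{\partial f_i}{\partial x_{i+1}}(t_1,x_1^*,\dots,x_{i+1}^*)=m_i$ for $i=1,\dots,\nu$. Let $p\in\{1,\dots,\nu\}$, $k=m_1+\dots+m_p$, $y^*=(x_1^*,\dots,x_p^*)\in\mathbb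 R^k$, and consider the control system $$\dot y=\varphi(t,y,v),\quad t\in J,\qquad \varphi(t,y,v)=\bigl(f_1(t,x_1,x_2),\dots,f_{p-1}(t,x_1,\dots,x_p),f_p(t,x_1,\dots,x_p,v)\bigr),$$ with state $y=(x_1,\dots,x_p)\in\mathbb R^k$ and control $v\in\mathbb R^{m_{p+1}}$. For a control $v(\cdot)\in L_\infty(J;\mathbb R^{m_{p+1}})$, let $t\mapsto y(t,T,\xi,v(\cdot))$ be its (Carathéodory) trajectory with value $\xi$ at time $T$. Let $\{y(\xi,\cdot)=(x_1(\xi,\cdot),\dots,x_p(\xi,\cdot))\}_{\xi\in\mathbb R^k}$ be a family of functions from $J$ to $\mathbb R^k$ such that * $\xi\mapsto x_i(\xi,\cdot)$ is of class $C(\mathbb R^k;C^1(J;\mathbb R^{m_i}))$ for $i=1,\dots,p$; * $\dot x_i(\xi,t)=f_i(t,x_1(\xi,t),\dots,x_{i+1}(\xi,t))$ for $1\le i\le p-1$, $\xi\in\mathbb R^k$, $t\in J$; * $y(\xi,t_1)=y^*$, $y(\xi,T)=\xi$ and $\dot x_p(\xi,t_1)=z_p^*$ for all $\xi\in\mathbb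 R^k$. Let $\delta:\mathbb R^k\to\,]0,+\infty[$ be continuous. **Claim.** There exist a continuous function $M:\mathbb R^k\to\,]0,+\infty[$ and a family $\{v(\xi,\cdot)\}_{\xi\in\mathbb R^k}$ of controls $v(\xi,\cdot):J\to\mathbb R^{m_{p+1}}$ such that 1. for each $\xi$ the control $v(\xi,\cdot)$ is piecewise constant on $J$, and the map $\xi\mapsto v(\xi,\cdot)$ is of class $C(\mathbb R^k;L_1(J;\mathbb R^{m_{p+1}}))$; 2. for each $\xi$ the trajectory $t\mapsto y(t,T,\xi,v(\xi,\cdot))$ is defined for all $t\in J$, and $$\bigl|\dot x_p(\xi,t)-f_p\bigl(t,y(t,T,\xi,v(\xi,\cdot)),v(\xi,t)\bigr)\bigr|<\delta(\xi)\qquad\text{for all }t\in J;$$ 3. $\|v(\xi,\cdot)\|_{L_\infty(J;\mathbb R^{m_{p+1}})}\le M(\xi)$ for each $\xi$. -/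

import Mathlib

open Set Filter Topology MeasureTheory

/-- The space `ℝ^{m_j}` of the `j`-th block, with its Euclidean norm. Blocks are numbered from `0`:
block `0` is the first block `x₁` of the state, and block `ν` is the control `u` of the full
system. -/
abbrev Block (m : ℕ → ℕ) (j : ℕ) : Type := EuclideanSpace ℝ (Fin (m j))

/-- The product `ℝ^{m_0} × … × ℝ^{m_{n-1}}` of the first `n` blocks. Only its topology and its
linear structure are used below, and these do not depend on the choice of a norm. -/
abbrev Blocks (m : ℕ → ℕ) (n : ℕ) : Type := (j : Fin n) → Block m j

/-- The right-hand sides of a triangular system: `f i t (x₀, …, xᵢ) xᵢ₊₁` is a vector of block `i`.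
Only the indices `i < ν` matter for a system with `ν` blocks. -/
abbrev TriangularField (m : ℕ → ℕ) : Type :=
  (i : ℕ) → ℝ → Blocks m (i + 1) → Block m (i + 1) → Block m i

/-- The first `i + 1` blocks of a point with `n` blocks. -/
def truncBlocks {m : ℕ → ℕ} {n : ℕ} (y : Blocks m n) (i : Fin n) : Blocks m (i + 1) :=
  fun j => y (Fin.castLE i.isLt j)

/-- The standing assumptions on a triangular system with `ν` blocks on the time interval
`[t₀, T]`: the block dimensions do not decrease, every `fᵢ` and its derivatives with respect to
the state and the control exist and are jointly continuous on `[t₀, T] × ℝ^{…}`, and every map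
`fᵢ(t, x₀, …, xᵢ, ·)` is of class `C^{m_{i+1} - m_i + 1}` and onto. -/
structure IsTriangularSystem (ν : ℕ) (m : ℕ → ℕ) (t₀ T : ℝ) (f : TriangularField m) : Prop where
  dim_le : ∀ i < ν, m i ≤ m (i + 1)
  continuousOn : ∀ i < ν, ContinuousOn
    (fun q : ℝ × (Blocks m (i + 1) × Block m (i + 1)) => f i q.1 q.2.1 q.2.2)
    (Icc t₀ T ×ˢ univ)
  differentiable : ∀ i < ν, ∀ t ∈ Icc t₀ T, Differentiable ℝ
    (fun w : Blocks m (i + 1) × Block m (i + 1) => f i t w.1 w.2)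
  continuousOn_fderiv : ∀ i < ν, ContinuousOn
    (fun q : ℝ × (Blocks m (i + 1) × Block m (i + 1)) =>
      fderiv ℝ (fun w : Blocks m (i + 1) × Block m (i + 1) => f i q.1 w.1 w.2) q.2)
    (Icc t₀ T ×ˢ univ)
  contDiff : ∀ i < ν, ∀ t ∈ Icc t₀ T, ∀ y : Blocks m (i + 1),
    ContDiff ℝ ((m (i + 1) - m i + 1 : ℕ) : WithTop ℕ∞) (f i t y)
  surjective : ∀ i < ν, ∀ t ∈ Icc t₀ T, ∀ y : Blocks m (i + 1), Function.Surjective (f i t y)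

/-- The points `x₀*, …, x_ν*` and `z₀*, …, z_{ν-1}*` satisfy, at time `t₁`,
`zᵢ* = fᵢ(t₁, x₀*, …, xᵢ₊₁*)` and `rank ∂fᵢ/∂xᵢ₊₁ (t₁, x₀*, …, xᵢ₊₁*) = mᵢ` for all `i < ν`. -/
def IsRegularReference (ν : ℕ) (m : ℕ → ℕ) (t₁ : ℝ) (f : TriangularField m)
    (xs zs : (j : ℕ) → Block m j) : Prop :=
  ∀ i < ν,
    zs i = f i t₁ (fun j : Fin (i + 1) => xs j) (xs (i + 1)) ∧
    Module.finrank ℝ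
      (LinearMap.range
        (fderiv ℝ (f i t₁ (fun j : Fin (i + 1) => xs j)) (xs (i + 1))).toLinearMap) = m i

/-- The right-hand side `φ(t, y, v)` of the system formed by the first `p + 1` equations: its state
is `y = (x₀, …, x_p)`, its control is `v = x_{p+1}`, and its `i`-th component is
`fᵢ(t, x₀, …, xᵢ, xᵢ₊₁)`. -/
def subsystemField {m : ℕ → ℕ} (f : TriangularField m) (p : ℕ) (t : ℝ)
    (y : Blocks m (p + 1)) (v : Block m (p + 1)) : Blocks m (p + 1) :=
  fun i => f i t (truncBlocks y i)
    (Fin.snoc (α := fun j : Fin (p + 2) => Block m j) y v i.succ)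

/-- `z` is defined on all of `J = [a, b]` and is there the (Carathéodory) trajectory of
`ẏ = φ(t, y, v(t))` with `z(τ) = η`, where `τ ∈ J`. -/
structure IsTrajectoryOn {m : ℕ → ℕ} (f : TriangularField m) (p : ℕ) (a b τ : ℝ)
    (η : Blocks m (p + 1)) (v : ℝ → Block m (p + 1)) (z : ℝ → Blocks m (p + 1)) : Prop where
  continuousOn : ContinuousOn z (Icc a b)
  integrableOn : IntegrableOn (fun s => subsystemField f p s (z s) (v s)) (Icc a b)
  integral_eq : ∀ t ∈ Icc a b, z t = η + ∫ s in τ..t, subsystemField f p s (z s) (v s)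

/-- The map `ξ ↦ x(ξ, ·)` is of class `C(X; C¹([a, b]; F))`, where `C¹([a, b]; F)` carries the norm
of uniform convergence of the function and of its derivative (one-sided at the end points). -/
def IsContinuousC1Family {X F : Type*} [TopologicalSpace X] [NormedAddCommGroup F]
    [NormedSpace ℝ F] (a b : ℝ) (x : X → ℝ → F) : Prop :=
  (∀ ξ, ContDiffOn ℝ 1 (x ξ) (Icc a b)) ∧
  ∀ ξ₀, TendstoUniformlyOn x (x ξ₀) (𝓝 ξ₀) (Icc a b) ∧
    TendstoUniformlyOn (fun ξ => derivWithin (x ξ) (Icc a b)) (derivWithin (x ξ₀) (Icc a b))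
      (𝓝 ξ₀) (Icc a b)

/-- The family `y(ξ, ·) = (x₀(ξ, ·), …, x_p(ξ, ·))`, `ξ ∈ ℝ^{m_0} × … × ℝ^{m_p}`, of functions on
`[t₁, T]` depends continuously on `ξ` in the `C¹` sense, satisfies the first `p` equations of the
system, and has the boundary values `y(ξ, t₁) = y*`, `y(ξ, T) = ξ`, `ẋ_p(ξ, t₁) = z_p*`. -/
structure IsReferenceFamily {m : ℕ → ℕ} (f : TriangularField m) (p : ℕ) (t₁ T : ℝ)
    (xs zs : (j : ℕ) → Block m j) (y : Blocks m (p + 1) → ℝ → Blocks m (p + 1)) : Prop where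
  c1_family : ∀ i : Fin (p + 1), IsContinuousC1Family t₁ T (fun ξ t => y ξ t i)
  equations : ∀ ξ, ∀ i : Fin p, ∀ t ∈ Icc t₁ T,
    derivWithin (fun s => y ξ s i.castSucc) (Icc t₁ T) t =
      f i t (truncBlocks (y ξ t) i.castSucc) (y ξ t i.succ)
  initial : ∀ ξ, y ξ t₁ = fun j : Fin (p + 1) => xs j
  terminal : ∀ ξ, y ξ T = ξ
  initial_deriv : ∀ ξ, derivWithin (fun s => y ξ s (Fin.last p)) (Icc t₁ T) t₁ = zs p

/-- `v` is piecewise constant on `[a, b]`: there is a finite partition `a = s₀ < … < s_N = b` such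
that `v` is constant on every open interval `(s_j, s_{j+1})`. -/
def IsPiecewiseConstantOn {F : Type*} (v : ℝ → F) (a b : ℝ) : Prop :=
  ∃ (N : ℕ) (s : Fin (N + 1) → ℝ), StrictMono s ∧ s 0 = a ∧ s (Fin.last N) = b ∧
    ∀ j : Fin N, ∃ c : F, ∀ t ∈ Ioo (s j.castSucc) (s j.succ), v t = c

/-! Time is reversed, `s = T - t`, so that every trajectory starts at its parameter `ξ` at `s = 0`.
The reference curve, reversed, solves `Y' = V(ξ, s, Y)`, where `V` keeps the first equations and
prescribes the reference velocity for the last block. The controlled field `F` differs from `V` only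
in that block, and the difference there is exactly the error to be estimated. Since `f p` is onto in
the control, every `(ξ, s, z)` admits a constant control `u` with `F = V` there, and by continuity
the same `u` keeps the error small for a short time from all nearby points.

The difficulty is to select these controls continuously in `ξ`. Each local choice is made into a
globally defined step (`exists_controlStep`) whose duration is a continuous bump function: away from
the chosen point nothing happens. By Lindelöf countably many steps suffice, and they are run in an
order in which each recurs infinitely often (`exists_recurrent_steps`). The sequence of control
values is then the same for all `ξ`; only the switching times vary, and they vary continuously.

The final time is reached. The error bound is chosen so small that Grönwall keeps the trajectory in
the unit tube around `Y`; its speed is therefore bounded, and if the times stayed below the end,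
times and states would converge. A recurrent step that makes uniform progress near the limit
contradicts this (`exists_stepState_time_eq`). The same argument at the final state shows that,
locally in `ξ`, finitely many steps suffice.

Local finiteness and continuous switching times give continuity in `L₁` and a locally bounded number
of control values, hence a continuous `M` by a partition of unity. Uniqueness on each switching
interval transfers the estimate to every Carathéodory trajectory. -/

/-! ### Local flows, jointly continuous in initial time, initial point and final time. -/

section LocalFlow

open Metric ODE in
/-- The Picard–Lindelöf theorem with a solution that stays in the ball on which the field is
controlled. -/
theorem IsPicardLindelof.exists_mem_closedBall {E : Type*} [NormedAddCommGroup E]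
    [NormedSpace ℝ E] [CompleteSpace E] {f : ℝ → E → E} {tmin tmax : ℝ} {t₀ : Icc tmin tmax}
    {x₀ x : E} {a r L K : NNReal} (hf : IsPicardLindelof f t₀ x₀ a r L K)
    (hx : x ∈ closedBall x₀ r) :
    ∃ α : ℝ → E, α t₀ = x ∧ (∀ t, α t ∈ closedBall x₀ a) ∧
      ∀ t ∈ Icc tmin tmax, HasDerivWithinAt α (f t (α t)) (Icc tmin tmax) t := by
  obtain ⟨α, hα⟩ := FunSpace.exists_isFixedPt_next hf hx
  refine ⟨α.compProj, by rw [FunSpace.compProj_val, ← hα, FunSpace.next_apply₀],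
    fun t => α.compProj_mem_closedBall hf.mul_max_le, fun t ht ↦ ?_⟩
  apply hasDerivWithinAt_picard_Icc t₀.2 hf.continuousOn_uncurry
    α.continuous_compProj.continuousOn (fun _ ht' ↦ α.compProj_mem_closedBall hf.mul_max_le)
    x ht |>.congr_of_mem _ ht
  intro t' ht'
  nth_rw 1 [← hα]
  rw [FunSpace.compProj_of_mem ht', FunSpace.next_apply]

variable {E : Type*} [NormedAddCommGroup E] [NormedSpace ℝ E]

/-- On an interval which is short with respect to the Lipschitz constant, the distance of two
solutions is controlled by their distance at any one time. -/
theorem norm_sub_le_two_mul_of_hasDerivWithinAt {G : ℝ → E → E} {K : NNReal} {B : Set E}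
    {a b τ t : ℝ} {w w' : ℝ → E} (hG : ∀ t ∈ Icc a b, LipschitzOnWith K (G t) B)
    (hw : ∀ t ∈ Icc a b, HasDerivWithinAt w (G t (w t)) (Icc a b) t)
    (hw' : ∀ t ∈ Icc a b, HasDerivWithinAt w' (G t (w' t)) (Icc a b) t)
    (hwB : ∀ t ∈ Icc a b, w t ∈ B) (hwB' : ∀ t ∈ Icc a b, w' t ∈ B)
    (hab : 2 * (K * (b - a)) ≤ 1) (hτ : τ ∈ Icc a b) (ht : t ∈ Icc a b) :
    ‖w t - w' t‖ ≤ 2 * ‖w τ - w' τ‖ := by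
  have hd : ∀ t ∈ Icc a b, HasDerivWithinAt (fun t => w t - w' t) (G t (w t) - G t (w' t))
      (Icc a b) t := fun t ht => (hw t ht).sub (hw' t ht)
  have hc : ContinuousOn (fun t => ‖w t - w' t‖) (Icc a b) :=
    (HasDerivWithinAt.continuousOn hd).norm
  -- At a maximum point `θ` of the distance the mean value inequality gives `max ≤ dist at τ + max /
  -- 2`. This works on both sides of `τ`, unlike a forward Grönwall estimate.
  obtain ⟨θ, hθ, hmax⟩ := isCompact_Icc.exists_isMaxOn ⟨τ, hτ⟩ hc
  have hle : ∀ t ∈ Icc a b, ‖w t - w' t‖ ≤ ‖w θ - w' θ‖ := fun t ht => hmax ht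
  have hbound : ∀ t ∈ Icc a b, ‖G t (w t) - G t (w' t)‖ ≤ K * ‖w θ - w' θ‖ := fun t ht =>
    ((hG t ht).norm_sub_le (hwB t ht) (hwB' t ht)).trans
      (mul_le_mul_of_nonneg_left (hle t ht) K.2)
  have h := (convex_Icc a b).norm_image_sub_le_of_norm_hasDerivWithin_le hd hbound hτ hθ
  have h1 : ‖θ - τ‖ ≤ b - a := by
    rw [Real.norm_eq_abs, abs_le]; constructor <;> linarith [hτ.1, hτ.2, hθ.1, hθ.2]
  have h2 : (K : ℝ) * ‖w θ - w' θ‖ * ‖θ - τ‖ ≤ K * ‖w θ - w' θ‖ * (b - a) := by gcongr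
  have h3 : (K : ℝ) * ‖w θ - w' θ‖ * (b - a) ≤ ‖w θ - w' θ‖ / 2 := by
    nlinarith [norm_nonneg (w θ - w' θ)]
  have h4 : ‖w θ - w' θ‖ ≤ ‖w τ - w' τ‖ + ‖(w θ - w' θ) - (w τ - w' τ)‖ := by
    simpa using norm_add_le (w τ - w' τ) ((w θ - w' θ) - (w τ - w' τ))
  linarith [hle t ht]

variable [ProperSpace E]

open Metric in
/-- The local flow of a continuous field that is Lipschitz on balls, jointly continuous in the
initial time, the initial point and the final time. -/
theorem exists_local_flow {G : ℝ → E → E} (hG : Continuous fun q : ℝ × E => G q.1 q.2)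
    (hlip : ∀ R : ℝ, ∃ K : NNReal, ∀ t, LipschitzOnWith K (G t) (closedBall 0 R))
    (s₀ : ℝ) (z₀ : E) {ρ : ℝ} (hρ : 0 < ρ) :
    ∃ c > 0, 2 * c ≤ ρ ∧ ∃ w : ℝ × E → ℝ → E,
      (∀ q ∈ closedBall s₀ c ×ˢ closedBall z₀ c, w q q.1 = q.2 ∧
        ∀ t ∈ Icc (s₀ - 2 * c) (s₀ + 2 * c), w q t ∈ closedBall z₀ ρ ∧
          HasDerivWithinAt (w q) (G t (w q t)) (Icc (s₀ - 2 * c) (s₀ + 2 * c)) t) ∧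
      ContinuousOn (fun x : (ℝ × E) × ℝ => w x.1 x.2)
        ((closedBall s₀ c ×ˢ closedBall z₀ c) ×ˢ Icc (s₀ - 2 * c) (s₀ + 2 * c)) := by
  obtain ⟨K, hK⟩ := hlip (‖z₀‖ + ρ)
  have hsub : closedBall z₀ ρ ⊆ closedBall 0 (‖z₀‖ + ρ) :=
    closedBall_subset_closedBall' (by rw [dist_zero_right, add_comm])
  obtain ⟨S, hS⟩ := ((isCompact_closedBall s₀ ρ).prod
    (isCompact_closedBall z₀ ρ)).exists_bound_of_continuousOn hG.continuousOn
  have hS0 : 0 ≤ S := (norm_nonneg _).trans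
    (hS (s₀, z₀) ⟨mem_closedBall_self hρ.le, mem_closedBall_self hρ.le⟩)
  have hK0 : (0 : ℝ) ≤ K := K.2
  -- From an initial time within `c` of `s₀` the ends of the interval are at most `3 * c` away, so
  -- Picard–Lindelöf needs `3 * S * c ≤ ρ - c`. The interval has length `4 * c`, and `8 * (K * c) ≤
  -- 1` makes it short for the two-solution estimate.
  obtain ⟨c, hc0, hc1, hc2, hc3⟩ : ∃ c > 0, 2 * c ≤ ρ ∧ c * (3 * S + 1) ≤ ρ ∧
      8 * (K * c) ≤ 1 := by
    refine ⟨min (ρ / 2) (min (ρ / (3 * S + 1)) (1 / (8 * K + 1))), by positivity, ?_, ?_, ?_⟩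
    · linarith [min_le_left (ρ / 2) (min (ρ / (3 * S + 1)) (1 / (8 * (K : ℝ) + 1)))]
    · rw [← le_div_iff₀ (by positivity)]
      exact (min_le_right _ _).trans (min_le_left _ _)
    · have h : min (ρ / 2) (min (ρ / (3 * S + 1)) (1 / (8 * (K : ℝ) + 1)))
          ≤ 1 / (8 * (K : ℝ) + 1) := (min_le_right _ _).trans (min_le_right _ _)
      have h0 : 0 ≤ min (ρ / 2) (min (ρ / (3 * S + 1)) (1 / (8 * (K : ℝ) + 1))) := by
        positivity
      rw [le_div_iff₀ (by positivity)] at h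
      linarith
  have hI : Icc (s₀ - 2 * c) (s₀ + 2 * c) ⊆ closedBall s₀ ρ := by
    rw [Real.closedBall_eq_Icc]; exact Icc_subset_Icc (by linarith) (by linarith)
  have hsol : ∀ q : ℝ × E, ∃ α : ℝ → E, q ∈ closedBall s₀ c ×ˢ closedBall z₀ c →
      α q.1 = q.2 ∧ (∀ t, α t ∈ closedBall z₀ ρ) ∧ ∀ t ∈ Icc (s₀ - 2 * c) (s₀ + 2 * c),
        HasDerivWithinAt α (G t (α t)) (Icc (s₀ - 2 * c) (s₀ + 2 * c)) t := by
    intro q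
    by_cases hq : q ∈ closedBall s₀ c ×ˢ closedBall z₀ c
    swap
    · exact ⟨fun _ => 0, fun h => absurd h hq⟩
    have hq1 : q.1 ∈ Icc (s₀ - c) (s₀ + c) := by
      rw [← Real.closedBall_eq_Icc]; exact hq.1
    have hP : IsPicardLindelof G (tmin := s₀ - 2 * c) (tmax := s₀ + 2 * c)
        ⟨q.1, by linarith [hq1.1], by linarith [hq1.2]⟩ z₀ ⟨ρ, hρ.le⟩ ⟨c, hc0.le⟩ ⟨S, hS0⟩ K := by
      refine ⟨fun t _ => (hK t).mono hsub, fun x _ => ?_, fun t ht x hx => hS (t, x) ⟨hI ht, hx⟩, ?_⟩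
      · exact (hG.comp (by fun_prop : Continuous fun t : ℝ => (t, x))).continuousOn
      · change S * max (s₀ + 2 * c - q.1) (q.1 - (s₀ - 2 * c)) ≤ ρ - c
        have : max (s₀ + 2 * c - q.1) (q.1 - (s₀ - 2 * c)) ≤ 3 * c :=
          max_le (by linarith [hq1.1]) (by linarith [hq1.2])
        nlinarith
    obtain ⟨α, h1, h2, h3⟩ := hP.exists_mem_closedBall hq.2
    exact ⟨α, fun _ => ⟨h1, h2, h3⟩⟩
  choose w hw using hsol
  refine ⟨c, hc0, hc1, w, fun q hq => ⟨(hw q hq).1, fun t ht => ⟨(hw q hq).2.1 t,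
    (hw q hq).2.2 t ht⟩⟩, ?_⟩
  have hspeed : ∀ q ∈ closedBall s₀ c ×ˢ closedBall z₀ c, ∀ t ∈ Icc (s₀ - 2 * c) (s₀ + 2 * c),
      ∀ t' ∈ Icc (s₀ - 2 * c) (s₀ + 2 * c), ‖w q t' - w q t‖ ≤ S * ‖t' - t‖ :=
    fun q hq t ht t' ht' =>
    (convex_Icc _ _).norm_image_sub_le_of_norm_hasDerivWithin_le (hw q hq).2.2
      (fun x hx => hS (x, w q x) ⟨hI hx, (hw q hq).2.1 x⟩) ht ht'
  have hmem : ∀ q ∈ closedBall s₀ c ×ˢ closedBall z₀ c,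
      q.1 ∈ Icc (s₀ - 2 * c) (s₀ + 2 * c) := by
    intro q hq
    have hq1 : q.1 ∈ Icc (s₀ - c) (s₀ + c) := by
      rw [← Real.closedBall_eq_Icc]; exact hq.1
    exact ⟨by linarith [hq1.1], by linarith [hq1.2]⟩
  intro x hx
  rw [ContinuousWithinAt, tendsto_iff_norm_sub_tendsto_zero]
  have hlim : Tendsto (fun y : (ℝ × E) × ℝ =>
      2 * (S * ‖x.1.1 - y.1.1‖ + ‖y.1.2 - x.1.2‖) + S * ‖y.2 - x.2‖)
      (𝓝[(closedBall s₀ c ×ˢ closedBall z₀ c) ×ˢ Icc (s₀ - 2 * c) (s₀ + 2 * c)] x) (𝓝 0) := by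
    have : Continuous (fun y : (ℝ × E) × ℝ =>
      2 * (S * ‖x.1.1 - y.1.1‖ + ‖y.1.2 - x.1.2‖) + S * ‖y.2 - x.2‖) := by fun_prop
    simpa using (this.tendsto x).mono_left nhdsWithin_le_nhds
  refine squeeze_zero' (Eventually.of_forall fun _ => norm_nonneg _) ?_ hlim
  filter_upwards [self_mem_nhdsWithin] with y hy
  -- The two solutions are compared at the initial time of the first one; the second has moved from
  -- its own initial point by at most `S` times the difference of the initial times.
  have e1 := norm_sub_le_two_mul_of_hasDerivWithinAt (B := closedBall z₀ ρ)
    (fun t _ => (hK t).mono hsub) (hw y.1 hy.1).2.2 (hw x.1 hx.1).2.2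
    (fun t _ => (hw y.1 hy.1).2.1 t) (fun t _ => (hw x.1 hx.1).2.1 t)
    (by linarith) (hmem _ hy.1) hy.2
  have e2 := hspeed x.1 hx.1 _ hx.2 _ hy.2
  have e3 := hspeed x.1 hx.1 _ (hmem _ hy.1) _ (hmem _ hx.1)
  rw [(hw y.1 hy.1).1] at e1
  rw [(hw x.1 hx.1).1] at e3
  have e4 : ‖y.1.2 - w x.1 y.1.1‖ ≤ S * ‖x.1.1 - y.1.1‖ + ‖y.1.2 - x.1.2‖ := by
    calc ‖y.1.2 - w x.1 y.1.1‖ = ‖(x.1.2 - w x.1 y.1.1) + (y.1.2 - x.1.2)‖ := by congr 1; abel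
      _ ≤ _ := (norm_add_le _ _).trans (by linarith)
  calc ‖w y.1 y.2 - w x.1 x.2‖ = ‖(w y.1 y.2 - w x.1 y.2) + (w x.1 y.2 - w x.1 x.2)‖ := by
        congr 1; abel
    _ ≤ _ := (norm_add_le _ _).trans (by linarith)

end LocalFlow

/-! ### Single control steps and their concatenation. -/

section Steering

variable {X E U : Type*} [PseudoMetricSpace X] [NormedAddCommGroup E] [NormedSpace ℝ E]

/-- A rule which, at every parameter `ξ`, time `s` and state `z`, applies one fixed control to
`ż = F(t, z, u)` for a duration that depends continuously on `(ξ, s, z)`, never runs past the time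
`b`, and keeps the velocity `ε(ξ)`-close to the field `V(ξ, t, z)`. -/
structure ControlStep (b : ℝ) (F : ℝ → E → U → E) (V : X → ℝ → E → E) (ε : X → ℝ) where
  /-- the control that is applied -/
  control : U
  /-- how long the control is applied -/
  duration : X × ℝ × E → ℝ
  /-- the resulting trajectory -/
  curve : X × ℝ × E → ℝ → E
  continuous_duration : Continuous duration
  continuous_endpoint : Continuous fun q => curve q (q.2.1 + duration q)
  duration_nonneg : ∀ q, 0 ≤ duration q
  add_duration_le : ∀ q, q.2.1 ≤ b → q.2.1 + duration q ≤ b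
  curve_start : ∀ q, curve q q.2.1 = q.2.2
  continuousOn_curve : ∀ q, ContinuousOn (curve q) (Icc q.2.1 (q.2.1 + duration q))
  hasDerivWithinAt_curve : ∀ q, ∀ t ∈ Ico q.2.1 (q.2.1 + duration q),
    HasDerivWithinAt (curve q) (F t (curve q t) control) (Ici t) t
  error_lt : ∀ q, ∀ t ∈ Ico q.2.1 (q.2.1 + duration q),
    ‖F t (curve q t) control - V q.1 t (curve q t)‖ < ε q.1

variable {b : ℝ} {F : ℝ → E → U → E} {V : X → ℝ → E → E} {ε : X → ℝ}

open Metric in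
-- The control that is exact at `q₀` stays `ε`-accurate on a ball around `q₀`. Cutting the duration
-- off continuously inside this ball makes the step globally defined, while near `q₀` it still
-- advances by a uniform `η` or up to `b`.
theorem exists_controlStep [ProperSpace E]
    (hF : ∀ u, Continuous fun q : ℝ × E => F q.1 q.2 u)
    (hFlip : ∀ u, ∀ R : ℝ, ∃ K : NNReal, ∀ t,
      LipschitzOnWith K (fun z => F t z u) (closedBall 0 R))
    (hV : Continuous fun q : X × ℝ × E => V q.1 q.2.1 q.2.2)
    (hsurj : ∀ ξ t z, ∃ u, F t z u = V ξ t z)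
    (hε : Continuous ε) (hε_pos : ∀ ξ, 0 < ε ξ) (q₀ : X × ℝ × E) :
    ∃ S : ControlStep b F V ε, ∃ η > 0, ∀ᶠ q in 𝓝 q₀, q.2.1 ≤ b →
      min b (q.2.1 + η) ≤ q.2.1 + S.duration q := by
  obtain ⟨u, hu⟩ := hsurj q₀.1 q₀.2.1 q₀.2.2
  have hopen : IsOpen {q : X × ℝ × E | ‖F q.2.1 q.2.2 u - V q.1 q.2.1 q.2.2‖ < ε q.1} :=
    isOpen_lt (((hF u).comp continuous_snd).sub hV).norm (hε.comp continuous_fst)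
  obtain ⟨r, hr, hball⟩ := Metric.isOpen_iff.1 hopen q₀ (by simpa [hu] using hε_pos q₀.1)
  obtain ⟨c, hc, hcr, w, hw, hwc⟩ :=
    exists_local_flow (hF u) (hFlip u) q₀.2.1 q₀.2.2 (half_pos hr)
  have hmem : ∀ q : X × ℝ × E, dist q q₀ ≤ c →
      q.2 ∈ closedBall q₀.2.1 c ×ˢ closedBall q₀.2.2 c := by
    intro q hq
    rw [Prod.dist_eq, Prod.dist_eq] at hq
    exact ⟨(le_max_left _ _).trans ((le_max_right _ _).trans hq),
      (le_max_right _ _).trans ((le_max_right _ _).trans hq)⟩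
  -- The duration vanishes at distance `c` from `q₀` and beyond, and never exceeds the time left
  -- before `b`.
  let ℓ : X × ℝ × E → ℝ := fun q => max 0 (min (c - dist q q₀) (b - q.2.1))
  have hℓc : Continuous ℓ := by fun_prop
  have hℓ0 : ∀ q, 0 ≤ ℓ q := fun q => le_max_left _ _
  have hℓle : ∀ q, ℓ q ≤ c := fun q =>
    max_le hc.le ((min_le_left _ _).trans (by linarith [dist_nonneg (x := q) (y := q₀)]))
  have hℓz : ∀ q, c ≤ dist q q₀ → ℓ q = 0 := fun q hq =>
    max_eq_left ((min_le_left _ _).trans (by linarith))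
  have htime : ∀ q : X × ℝ × E, dist q q₀ ≤ c → ∀ t ∈ Icc q.2.1 (q.2.1 + ℓ q),
      t ∈ Icc (q₀.2.1 - 2 * c) (q₀.2.1 + 2 * c) := by
    intro q hq t ht
    have h := (hmem q hq).1
    rw [Real.closedBall_eq_Icc] at h
    exact ⟨by linarith [h.1, ht.1], by linarith [h.2, ht.2, hℓle q]⟩
  -- The two branches agree at the endpoint of the step when `dist q q₀ = c`, because the duration
  -- is zero there; hence the endpoint is continuous in `q`.
  let γ : X × ℝ × E → ℝ → E := fun q t => if dist q q₀ ≤ c then w q.2 t else q.2.2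
  have hγ : ∀ q, dist q q₀ ≤ c → γ q = w q.2 := fun q hq => by
    funext t; simp only [γ, if_pos hq]
  have hlt : ∀ q, ∀ t ∈ Ico q.2.1 (q.2.1 + ℓ q), dist q q₀ ≤ c := by
    intro q t ht
    by_contra h
    have := hℓz q (not_le.1 h).le
    rw [this, add_zero] at ht
    exact absurd ht.1 (not_le.2 ht.2)
  refine ⟨{ control := u, duration := ℓ, curve := γ, continuous_duration := hℓc,
            continuous_endpoint := ?_, duration_nonneg := hℓ0, add_duration_le := ?_,
            curve_start := ?_, continuousOn_curve := ?_, hasDerivWithinAt_curve := ?_,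
            error_lt := ?_ }, c / 2, half_pos hc, ?_⟩
  · refine continuous_if_le (by fun_prop) continuous_const ?_ (by fun_prop) ?_
    · refine hwc.comp (f := fun q : X × ℝ × E => (q.2, q.2.1 + ℓ q)) (by fun_prop) ?_
      intro q hq
      exact ⟨hmem q hq, htime q hq _ ⟨by linarith [hℓ0 q], le_rfl⟩⟩
    · intro q hq
      rw [hℓz q hq.ge, add_zero]
      exact (hw q.2 (hmem q hq.le)).1
  · intro q hq
    have : ℓ q ≤ b - q.2.1 := max_le (by linarith) (min_le_right _ _)
    linarith
  · intro q
    by_cases hq : dist q q₀ ≤ c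
    · rw [hγ q hq]; exact (hw q.2 (hmem q hq)).1
    · simp only [γ, if_neg hq]
  · intro q
    by_cases hq : dist q q₀ ≤ c
    · rw [hγ q hq]
      exact (HasDerivWithinAt.continuousOn fun t ht => ((hw q.2 (hmem q hq)).2 t ht).2).mono
        (htime q hq)
    · simp only [γ, if_neg hq]; exact continuousOn_const
  · intro q t ht
    have hq := hlt q t ht
    rw [hγ q hq]
    have h1 := htime q hq t ⟨ht.1, ht.2.le⟩
    have h2 := htime q hq _ ⟨by linarith [hℓ0 q], le_rfl⟩
    exact ((hw q.2 (hmem q hq)).2 t h1).2.mono_of_mem_nhdsWithin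
      (mem_of_superset (Icc_mem_nhdsGE (ht.2.trans_le h2.2)) (Icc_subset_Icc_left h1.1))
  · intro q t ht
    have hq := hlt q t ht
    rw [hγ q hq]
    have h1 := htime q hq t ⟨ht.1, ht.2.le⟩
    have h2 := ((hw q.2 (hmem q hq)).2 t h1).1
    refine hball (show (q.1, t, w q.2 t) ∈ ball q₀ r from ?_)
    rw [mem_ball, Prod.dist_eq, Prod.dist_eq]
    refine max_lt ?_ (max_lt ?_ ?_)
    · rw [Prod.dist_eq] at hq
      exact ((le_max_left _ _).trans hq).trans_lt (by linarith)
    · change dist t q₀.2.1 < r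
      rw [Real.dist_eq, abs_lt]
      constructor <;> linarith [h1.1, h1.2]
    · exact (mem_closedBall.1 h2).trans_lt (by linarith)
  · filter_upwards [ball_mem_nhds q₀ (half_pos hc)] with q hq hqb
    rw [mem_ball] at hq
    change min b (q.2.1 + c / 2) ≤ q.2.1 + ℓ q
    have : min (c / 2) (b - q.2.1) ≤ ℓ q :=
      (min_le_min_right _ (by linarith)).trans (le_max_right _ _)
    rcases min_le_iff.1 this with h | h
    · exact (min_le_right _ _).trans (by linarith)
    · exact (min_le_left _ _).trans (by linarith)

namespace ControlStep

/-- The parameter, time and state after a step. -/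
def next (S : ControlStep b F V ε) (q : X × ℝ × E) : X × ℝ × E :=
  (q.1, q.2.1 + S.duration q, S.curve q (q.2.1 + S.duration q))

theorem continuous_next (S : ControlStep b F V ε) : Continuous S.next := by
  have := S.continuous_duration
  exact continuous_fst.prodMk ((by fun_prop : Continuous fun q : X × ℝ × E =>
    q.2.1 + S.duration q).prodMk S.continuous_endpoint)

theorem next_eq_self (S : ControlStep b F V ε) {q : X × ℝ × E} (hq : q.2.1 = b) :
    S.next q = q := by
  have h : S.duration q = 0 := le_antisymm (by linarith [S.add_duration_le q hq.le])
    (S.duration_nonneg q)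
  simp [next, h, S.curve_start]

end ControlStep

/-- The parameter, time and state after the first `n` steps of a sequence of steps. -/
def stepState (S : ℕ → ControlStep b F V ε) (q : X × ℝ × E) : ℕ → X × ℝ × E
  | 0 => q
  | n + 1 => (S n).next (stepState S q n)

section stepState

variable (S : ℕ → ControlStep b F V ε)

theorem continuous_stepState (n : ℕ) : Continuous fun q => stepState S q n := by
  induction n with
  | zero => exact continuous_id
  | succ n ih => exact (S n).continuous_next.comp ih

theorem stepState_fst (q : X × ℝ × E) (n : ℕ) : (stepState S q n).1 = q.1 := by
  induction n with
  | zero => rfl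
  | succ n ih => exact ih

theorem stepState_time_mono (q : X × ℝ × E) : Monotone fun n => (stepState S q n).2.1 :=
  monotone_nat_of_le_succ fun n => le_add_of_nonneg_right ((S n).duration_nonneg _)

theorem stepState_time_le {q : X × ℝ × E} (hq : q.2.1 ≤ b) (n : ℕ) :
    (stepState S q n).2.1 ≤ b := by
  induction n with
  | zero => exact hq
  | succ n ih => exact (S n).add_duration_le _ ih

theorem stepState_eq_of_time_eq {q : X × ℝ × E} {n k : ℕ} (h : (stepState S q n).2.1 = b)
    (hnk : n ≤ k) : stepState S q k = stepState S q n := by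
  induction k, hnk using Nat.le_induction with
  | base => rfl
  | succ k _ ih => rw [stepState, ih, (S k).next_eq_self h]

/-- The trajectory that results from the first `n` steps. -/
theorem exists_curve (q : X × ℝ × E) (n : ℕ) :
    ∃ Z : ℝ → E, ContinuousOn Z (Icc q.2.1 (stepState S q n).2.1) ∧
      (∀ k ≤ n, Z (stepState S q k).2.1 = (stepState S q k).2.2) ∧
      ∀ k < n, ∀ t ∈ Ico (stepState S q k).2.1 (stepState S q (k + 1)).2.1,
        HasDerivWithinAt Z (F t (Z t) (S k).control) (Ici t) t ∧
          ‖F t (Z t) (S k).control - V q.1 t (Z t)‖ < ε q.1 := by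
  induction n with
  | zero =>
    refine ⟨fun _ => q.2.2, continuousOn_const, fun k hk => ?_, fun k hk => absurd hk (by simp)⟩
    obtain rfl : k = 0 := Nat.le_zero.1 hk
    rfl
  | succ n ih =>
    obtain ⟨Z, hZc, hZn, hZ⟩ := ih
    set p := stepState S q n with hp
    have hmono := stepState_time_mono S q
    have hp' : stepState S q (n + 1) = (S n).next p := rfl
    have hle : p.2.1 ≤ p.2.1 + (S n).duration p := by linarith [(S n).duration_nonneg p]
    have hglue : Z p.2.1 = (S n).curve p p.2.1 := by
      rw [(S n).curve_start, hZn n le_rfl]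
    let Z' : ℝ → E := fun t => if t ≤ p.2.1 then Z t else (S n).curve p t
    have hZ'l : ∀ t ≤ p.2.1, Z' t = Z t := fun t ht => if_pos ht
    have hZ'r : ∀ t, p.2.1 ≤ t → Z' t = (S n).curve p t := by
      intro t ht
      rcases ht.eq_or_lt with rfl | h
      · rw [hZ'l _ le_rfl, hglue]
      · exact if_neg (not_le.2 h)
    refine ⟨Z', ?_, ?_, ?_⟩
    · have hq : q.2.1 ≤ p.2.1 := hmono (Nat.zero_le n)
      rw [hp']
      change ContinuousOn Z' (Icc q.2.1 (p.2.1 + (S n).duration p))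
      rw [← Icc_union_Icc_eq_Icc hq hle]
      exact (hZc.congr fun t ht => hZ'l t ht.2).union_of_isClosed
        (((S n).continuousOn_curve p).congr fun t ht => hZ'r t ht.1) isClosed_Icc isClosed_Icc
    · intro k hk
      rcases Nat.lt_or_eq_of_le hk with h | rfl
      · have hkn := Nat.lt_succ_iff.1 h
        rw [hZ'l _ (hmono hkn), hZn k hkn]
      · exact hZ'r _ hle
    · intro k hk t ht
      rcases Nat.lt_or_eq_of_le (Nat.lt_succ_iff.1 hk) with h | rfl
      · have htp : t < p.2.1 := ht.2.trans_le (hmono h)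
        rw [hZ'l t htp.le]
        refine ⟨((hZ k h t ht).1.congr_of_eventuallyEq ?_ (hZ'l t htp.le)), (hZ k h t ht).2⟩
        filter_upwards [mem_nhdsWithin_of_mem_nhds (Iic_mem_nhds htp)] with x hx using hZ'l x hx
      · rw [hZ'r t ht.1]
        refine ⟨((S k).hasDerivWithinAt_curve p t ht).congr (fun x hx => hZ'r x (ht.1.trans hx))
          (hZ'r t ht.1), ?_⟩
        have := (S k).error_lt p t ht
        rwa [hp, stepState_fst, ← hp] at this

end stepState

end Steering

/-! ### Reaching the final time, with locally finitely many steps. -/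

section Steering

variable {X E U : Type*} [PseudoMetricSpace X] [NormedAddCommGroup E] [NormedSpace ℝ E]
variable {b : ℝ} {F : ℝ → E → U → E} {V : X → ℝ → E → E} {ε : X → ℝ}

theorem exists_mem_Ico_succ {σ : ℕ → ℝ} {t : ℝ} {n : ℕ} (h₀ : σ 0 ≤ t) (hn : t < σ n) :
    ∃ k < n, t ∈ Ico (σ k) (σ (k + 1)) := by
  induction n with
  | zero => exact absurd h₀ (not_le.2 hn)
  | succ n ih =>
    by_cases h : t < σ n
    · obtain ⟨k, hk, hkt⟩ := ih h
      exact ⟨k, by omega, hkt⟩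
    · exact ⟨n, by omega, not_lt.1 h, hn⟩

theorem gronwallBound_zero_eq_mul (K ε x : ℝ) :
    gronwallBound 0 K ε x = ε * gronwallBound 0 K 1 x := by
  unfold gronwallBound
  split_ifs <;> ring

theorem gronwallBound_zero_one_nonneg {K x : ℝ} (hK : 0 ≤ K) (hx : 0 ≤ x) :
    0 ≤ gronwallBound 0 K 1 x := by
  simpa [gronwallBound_x0] using gronwallBound_mono le_rfl zero_le_one hK hx

open Metric in
/-- An approximate solution stays in the unit tube around an exact one if the Grönwall bound
allows it. -/
theorem dist_lt_one_of_gronwallBound {V : ℝ → E → E} {K : NNReal} {Y Z : ℝ → E} {σ ε : ℝ}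
    (hσb : σ ≤ b)
    (hV : ∀ t ∈ Ico 0 b, LipschitzOnWith K (V t) (closedBall (Y t) 1))
    (hYc : ContinuousOn Y (Icc 0 b))
    (hY : ∀ t ∈ Ico 0 b, HasDerivWithinAt Y (V t (Y t)) (Ici t) t)
    (hZc : ContinuousOn Z (Icc 0 σ))
    (hZ : ∀ t ∈ Ico 0 σ, ∃ z', HasDerivWithinAt Z z' (Ici t) t ∧ ‖z' - V t (Z t)‖ ≤ ε)
    (hε : 0 ≤ ε) (h0 : Z 0 = Y 0) (hK : gronwallBound 0 K ε b < 1) :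
    ∀ t ∈ Icc 0 σ, dist (Z t) (Y t) < 1 := by
  by_contra! hcon
  obtain ⟨t₁, ht₁, ht₁'⟩ := hcon
  choose! Z' hZ' hZe using hZ
  have hdc : ContinuousOn (fun t => dist (Z t) (Y t)) (Icc 0 σ) :=
    continuous_dist.comp_continuousOn (hZc.prodMk (hYc.mono (Icc_subset_Icc_right hσb)))
  have hclosed : IsClosed (Icc 0 σ ∩ (fun t => dist (Z t) (Y t)) ⁻¹' Ici 1) :=
    hdc.preimage_isClosed_of_isClosed isClosed_Icc isClosed_Ici
  have hbdd : BddBelow (Icc 0 σ ∩ (fun t => dist (Z t) (Y t)) ⁻¹' Ici 1) :=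
    ⟨0, fun t ht => ht.1.1⟩
  obtain ⟨⟨hτ0, hτσ⟩, hτ1⟩ := hclosed.csInf_mem ⟨t₁, ht₁, ht₁'⟩ hbdd
  set τ := sInf (Icc 0 σ ∩ (fun t => dist (Z t) (Y t)) ⁻¹' Ici 1) with hτ
  have hlt : ∀ t ∈ Ico 0 τ, dist (Z t) (Y t) < 1 := by
    intro t ht
    by_contra! h
    exact absurd (csInf_le hbdd ⟨⟨ht.1, ht.2.le.trans hτσ⟩, h⟩) (not_le.2 ht.2)
  -- Before the first exit time `τ` the approximate solution is in the tube, where the Lipschitz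
  -- bound holds, so Grönwall applies up to `τ` and contradicts the exit.
  have key := dist_le_of_approx_trajectories_ODE_of_mem (a := 0) (b := τ) (K := K) (δ := 0)
    (εf := ε) (εg := 0) (s := fun t => closedBall (Y t) 1) (f := Z) (g := Y) (f' := Z')
    (g' := fun t => V t (Y t)) (v := V)
    (fun t ht => hV t ⟨ht.1, ht.2.trans_le (hτσ.trans hσb)⟩)
    (hZc.mono (Icc_subset_Icc_right hτσ)) (fun t ht => hZ' t ⟨ht.1, ht.2.trans_le hτσ⟩)
    (fun t ht => by rw [dist_eq_norm]; exact hZe t ⟨ht.1, ht.2.trans_le hτσ⟩)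
    (fun t ht => (hlt t ht).le) (hYc.mono (Icc_subset_Icc_right (hτσ.trans hσb)))
    (fun t ht => hY t ⟨ht.1, ht.2.trans_le (hτσ.trans hσb)⟩) (fun t _ => (dist_self _).le)
    (fun t _ => mem_closedBall_self zero_le_one) (by simp [h0]) τ ⟨hτ0, le_rfl⟩
  rw [add_zero, sub_zero] at key
  have h2 := gronwallBound_mono le_rfl hε K.2 (hτσ.trans hσb)
  exact absurd hτ1 (not_le.2 ((key.trans h2).trans_lt hK))

/-- A sequence of steps such that near every point some step that makes uniform progress recurs
infinitely often. -/
theorem exists_recurrent_steps [Nonempty X] [SecondCountableTopology X] [ProperSpace E]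
    (H : ∀ q₀ : X × ℝ × E, ∃ S : ControlStep b F V ε, ∃ η > 0, ∀ᶠ q in 𝓝 q₀, q.2.1 ≤ b →
      min b (q.2.1 + η) ≤ q.2.1 + S.duration q) :
    ∃ S : ℕ → ControlStep b F V ε, ∀ q₀ : X × ℝ × E, ∃ S₀ : ControlStep b F V ε,
      (∃ᶠ n in atTop, S n = S₀) ∧ ∃ η > 0, ∀ᶠ q in 𝓝 q₀, q.2.1 ≤ b →
        min b (q.2.1 + η) ≤ q.2.1 + S₀.duration q := by
  choose S η hη hS using H
  obtain ⟨s, hs, hcov⟩ := TopologicalSpace.countable_cover_nhds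
    fun q₀ => eventually_eventually_nhds.2 (hS q₀)
  have hne : s.Nonempty := by
    obtain ⟨q⟩ : Nonempty (X × ℝ × E) := inferInstance
    have hq : q ∈ ⋃ x ∈ s, {y | ∀ᶠ q in 𝓝 y, q.2.1 ≤ b →
      min b (q.2.1 + η x) ≤ q.2.1 + (S x).duration q} := hcov ▸ mem_univ q
    obtain ⟨x, hx, -⟩ := mem_iUnion₂.1 hq
    exact ⟨x, hx⟩
  obtain ⟨e, rfl⟩ := hs.exists_eq_range hne
  refine ⟨fun n => S (e n.unpair.1), fun q₀ => ?_⟩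
  have hq : q₀ ∈ ⋃ x ∈ range e, {y | ∀ᶠ q in 𝓝 y, q.2.1 ≤ b →
      min b (q.2.1 + η x) ≤ q.2.1 + (S x).duration q} := hcov ▸ mem_univ q₀
  obtain ⟨_, ⟨j, rfl⟩, hj⟩ := mem_iUnion₂.1 hq
  -- The first component of `Nat.unpair` takes every value infinitely often, so each step of the
  -- countable family recurs.
  refine ⟨S (e j), frequently_atTop.2 fun N => ⟨Nat.pair j N, Nat.right_le_pair j N, ?_⟩,
    η (e j), hη _, hj⟩
  simp

open Metric in
/-- A sequence of steps with recurrent progress reaches the time `b`. -/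
theorem exists_stepState_time_eq [ProperSpace E] {Y : ℝ → E} {K : NNReal}
    (S : ℕ → ControlStep b F V ε)
    (hS : ∀ q₀ : X × ℝ × E, ∃ S₀ : ControlStep b F V ε,
      (∃ᶠ n in atTop, S n = S₀) ∧ ∃ η > 0, ∀ᶠ q in 𝓝 q₀, q.2.1 ≤ b →
        min b (q.2.1 + η) ≤ q.2.1 + S₀.duration q)
    (hb : 0 ≤ b) (ξ : X) (hV : Continuous fun q : ℝ × E => V ξ q.1 q.2)
    (hVlip : ∀ t ∈ Ico 0 b, LipschitzOnWith K (V ξ t) (closedBall (Y t) 1))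
    (hYc : ContinuousOn Y (Icc 0 b))
    (hY : ∀ t ∈ Ico 0 b, HasDerivWithinAt Y (V ξ t (Y t)) (Ici t) t)
    (hε : 0 ≤ ε ξ) (hK : gronwallBound 0 K (ε ξ) b < 1) :
    ∃ n, (stepState S (ξ, 0, Y 0) n).2.1 = b := by
  by_contra! hne
  set q := stepState S (ξ, 0, Y 0) with hq
  have hmono : Monotone fun n => (q n).2.1 := stepState_time_mono S _
  have hleb : ∀ n, (q n).2.1 ≤ b := stepState_time_le S hb
  have hltb : ∀ n, (q n).2.1 < b := fun n => (hleb n).lt_of_ne (hne n)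
  obtain ⟨R, hR⟩ := isCompact_Icc.exists_bound_of_continuousOn hYc
  obtain ⟨C, hC⟩ := ((isCompact_Icc (a := (0 : ℝ)) (b := b)).prod
    (isCompact_closedBall (0 : E) (R + 1))).exists_bound_of_continuousOn hV.continuousOn
  -- Inside the tube the speed is at most `C + ε ξ`, so the states form a Cauchy sequence because
  -- the times converge.
  have hdist : ∀ k n, k ≤ n → dist (q k).2.2 (q n).2.2 ≤
      (C + ε ξ) * ((q n).2.1 - (q k).2.1) := by
    intro k n hkn
    obtain ⟨Z, hZc, hZn, hZ⟩ := exists_curve S (ξ, 0, Y 0) n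
    have hZ0 : Z 0 = Y 0 := hZn 0 (Nat.zero_le n)
    have hex : ∀ t ∈ Ico 0 (q n).2.1, ∃ z', HasDerivWithinAt Z z' (Ici t) t ∧
        ‖z' - V ξ t (Z t)‖ ≤ ε ξ := by
      intro t ht
      obtain ⟨j, hj, hjt⟩ := exists_mem_Ico_succ (σ := fun n => (q n).2.1) ht.1 ht.2
      exact ⟨_, (hZ j hj t hjt).1, (hZ j hj t hjt).2.le⟩
    have htube := dist_lt_one_of_gronwallBound (hleb n) hVlip hYc hY hZc hex hε hZ0 hK
    choose! Z' hZ' hZe using hex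
    have hk0 : 0 ≤ (q k).2.1 := hmono (Nat.zero_le k)
    have hbound : ∀ t ∈ Ico (q k).2.1 (q n).2.1, ‖Z' t‖ ≤ C + ε ξ := by
      intro t ht
      have ht' : t ∈ Ico 0 (q n).2.1 := ⟨hk0.trans ht.1, ht.2⟩
      have htb : t ∈ Icc 0 b := ⟨ht'.1, ht.2.le.trans (hleb n)⟩
      have hZR : Z t ∈ closedBall (0 : E) (R + 1) := by
        rw [mem_closedBall_zero_iff]
        have := htube t ⟨ht'.1, ht.2.le⟩
        rw [dist_eq_norm] at this
        calc ‖Z t‖ = ‖Y t + (Z t - Y t)‖ := by congr 1; abel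
          _ ≤ _ := (norm_add_le _ _).trans (add_le_add (hR t htb) this.le)
      calc ‖Z' t‖ = ‖V ξ t (Z t) + (Z' t - V ξ t (Z t))‖ := by congr 1; abel
        _ ≤ _ := (norm_add_le _ _).trans (add_le_add (hC (t, Z t) ⟨htb, hZR⟩) (hZe t ht'))
    have := norm_image_sub_le_of_norm_deriv_right_le_segment
      (hZc.mono (Icc_subset_Icc_left hk0)) (fun t ht => hZ' t ⟨hk0.trans ht.1, ht.2⟩) hbound
      (q n).2.1 ⟨hmono hkn, le_rfl⟩
    rwa [hZn n le_rfl, hZn k hkn, ← dist_eq_norm, dist_comm] at this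
  have hlim := tendsto_atTop_ciSup hmono ⟨b, by rintro _ ⟨n, rfl⟩; exact hleb n⟩
  set s := ⨆ n, (q n).2.1 with hs
  have hles : ∀ n, (q n).2.1 ≤ s := fun n => hmono.ge_of_tendsto hlim n
  have hcauchy : CauchySeq fun n => (q n).2.2 := by
    refine cauchySeq_of_le_tendsto_0 (fun n => 2 * (|C + ε ξ| * (s - (q n).2.1))) ?_ ?_
    · have hb' : ∀ N n, N ≤ n → dist (q N).2.2 (q n).2.2 ≤ |C + ε ξ| * (s - (q N).2.1) := by
        intro N n hNn
        refine (hdist N n hNn).trans ?_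
        have h1 : 0 ≤ (q n).2.1 - (q N).2.1 := sub_nonneg.2 (hmono hNn)
        have h2 := hles n
        gcongr
        exact le_abs_self _
      intro n m N hn hm
      have h1 := hb' N n hn
      have h2 := hb' N m hm
      linarith [dist_triangle_left (q n).2.2 (q m).2.2 (q N).2.2]
    · simpa using ((hlim.const_sub s).const_mul |C + ε ξ|).const_mul 2
  obtain ⟨z, hz⟩ := cauchySeq_tendsto_of_complete hcauchy
  have hqlim : Tendsto q atTop (𝓝 (ξ, s, z)) := by
    have h1 : Tendsto (fun n => (q n).1) atTop (𝓝 ξ) := by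
      simp only [hq, stepState_fst]; exact tendsto_const_nhds
    exact h1.prodMk_nhds (hlim.prodMk_nhds hz)
  obtain ⟨S₀, hfreq, η, hη, hev⟩ := hS (ξ, s, z)
  -- An occurrence of `S₀` so late that the state is near the limit and the time exceeds `s - η`:
  -- the next time would either be `b` or exceed the supremum `s`.
  obtain ⟨n, hn, hn1, hn2⟩ := (hfreq.and_eventually ((hqlim.eventually hev).and
    (hlim.eventually (lt_mem_nhds (sub_lt_self s hη))))).exists
  have hstep : (q n).2.1 + S₀.duration (q n) = (q (n + 1)).2.1 := by rw [← hn]; rfl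
  have := hn1 (hleb n)
  rw [hstep] at this
  rcases min_le_iff.1 this with h | h
  · exact absurd (hltb (n + 1)) (not_lt.2 h)
  · linarith [hles (n + 1)]

open Metric in
/-- Approximate steering along a family of trajectories of a field `V` by piecewise constant
controls whose switching times depend continuously on the parameter. -/
theorem exists_steering [Nonempty X] [SecondCountableTopology X] [ProperSpace E] [T2Space X]
    {Y : X → ℝ → E} {δ : X → ℝ} (hb : 0 ≤ b)
    (hF : ∀ u, Continuous fun q : ℝ × E => F q.1 q.2 u)
    (hFlip : ∀ u, ∀ R : ℝ, ∃ K : NNReal, ∀ t,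
      LipschitzOnWith K (fun z => F t z u) (closedBall 0 R))
    (hV : Continuous fun q : X × ℝ × E => V q.1 q.2.1 q.2.2)
    (hVlip : ∀ R : ℝ, ∃ K : NNReal, ∀ ξ t, LipschitzOnWith K (V ξ t) (closedBall 0 R))
    (hsurj : ∀ ξ t z, ∃ u, F t z u = V ξ t z)
    (hY : Continuous fun q : X × ℝ => Y q.1 q.2)
    (hYV : ∀ ξ, ∀ t ∈ Ico 0 b, HasDerivWithinAt (Y ξ) (V ξ t (Y ξ t)) (Ici t) t)
    (hδ : Continuous δ) (hδ_pos : ∀ ξ, 0 < δ ξ) :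
    ∃ (σ : ℕ → X → ℝ) (u : ℕ → U), (∀ n, Continuous (σ n)) ∧ (∀ ξ, σ 0 ξ = 0) ∧
      (∀ ξ, Monotone fun n => σ n ξ) ∧ (∀ n ξ, σ n ξ ≤ b) ∧
      (∀ ξ₀, ∃ N, ∀ᶠ ξ in 𝓝 ξ₀, σ N ξ = b) ∧
      ∀ ξ, ∃ Z : ℝ → E, ContinuousOn Z (Icc 0 b) ∧ Z 0 = Y ξ 0 ∧
        ∀ n, ∀ t ∈ Ico (σ n ξ) (σ (n + 1) ξ),
          HasDerivWithinAt Z (F t (Z t) (u n)) (Ici t) t ∧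
            ‖F t (Z t) (u n) - V ξ t (Z t)‖ < δ ξ := by
  -- The admissible tolerances at `ξ` form an interval, as the Grönwall bound with zero initial
  -- error is linear in `e`. Locally constant choices can therefore be glued by a partition of
  -- unity.
  obtain ⟨ε, hε⟩ : ∃ ε : C(X, ℝ), ∀ ξ, ε ξ ∈ {e : ℝ | 0 < e ∧ e ≤ δ ξ ∧ ∃ K : NNReal,
      (∀ t ∈ Ico 0 b, LipschitzOnWith K (V ξ t) (closedBall (Y ξ t) 1)) ∧
        gronwallBound 0 K e b < 1} := by
    refine exists_continuous_forall_mem_convex_of_local_const (fun ξ => ?_) fun ξ₀ => ?_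
    · refine OrdConnected.convex ⟨?_⟩
      rintro e₁ ⟨h1, -, -⟩ e₂ ⟨-, h2, K, hK, hKg⟩ e ⟨he1, he2⟩
      refine ⟨h1.trans_le he1, he2.trans h2, K, hK, lt_of_le_of_lt ?_ hKg⟩
      rw [gronwallBound_zero_eq_mul, gronwallBound_zero_eq_mul _ e₂]
      exact mul_le_mul_of_nonneg_right he2 (gronwallBound_zero_one_nonneg K.2 hb)
    · obtain ⟨R, hR⟩ := (isCompact_Icc (a := (0 : ℝ)) (b := b)).exists_bound_of_continuousOn
        (f := Y ξ₀) (hY.comp (by fun_prop : Continuous fun t : ℝ => (ξ₀, t))).continuousOn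
      -- For `ξ` near `ξ₀` the curve stays in the ball of radius `R + 1`; the tube adds `1`.
      obtain ⟨K, hK⟩ := hVlip (R + 2)
      have hnear : ∀ᶠ ξ in 𝓝 ξ₀, ∀ t ∈ Icc 0 b, ‖Y ξ t‖ < R + 1 := by
        refine isCompact_Icc.eventually_forall_of_forall_eventually fun t ht => ?_
        exact hY.norm.continuousAt.eventually (gt_mem_nhds ((hR t ht).trans_lt (by linarith)))
      obtain ⟨e, he0, heδ, heg⟩ : ∃ e > 0, e ≤ δ ξ₀ / 2 ∧ gronwallBound 0 K e b < 1 := by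
        refine ⟨min (δ ξ₀ / 2) (1 / (gronwallBound 0 K 1 b + 1)), ?_, min_le_left _ _, ?_⟩
        · have := hδ_pos ξ₀
          have : 0 ≤ gronwallBound 0 (K : ℝ) 1 b := gronwallBound_zero_one_nonneg K.2 hb
          positivity
        · have hg : 0 ≤ gronwallBound 0 (K : ℝ) 1 b := gronwallBound_zero_one_nonneg K.2 hb
          rw [gronwallBound_zero_eq_mul]
          calc _ ≤ 1 / (gronwallBound 0 K 1 b + 1) * gronwallBound 0 K 1 b :=
                mul_le_mul_of_nonneg_right (min_le_right _ _) hg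
            _ < 1 := by
                rw [one_div, inv_mul_lt_iff₀ (by linarith)]; linarith
      refine ⟨e, ?_⟩
      filter_upwards [hnear, hδ.continuousAt.eventually
        (lt_mem_nhds (half_lt_self (hδ_pos ξ₀)))] with ξ h1 h2
      refine ⟨he0, heδ.trans h2.le, K, fun t ht => (hK ξ t).mono ?_, heg⟩
      refine closedBall_subset_closedBall' ?_
      rw [dist_zero_right]
      linarith [h1 t ⟨ht.1, ht.2.le⟩]
  obtain ⟨S, hS⟩ := exists_recurrent_steps fun q₀ =>
    exists_controlStep (b := b) hF hFlip hV hsurj ε.continuous (fun ξ => (hε ξ).1) q₀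
  have hYξ : ∀ ξ, Continuous (Y ξ) := fun ξ =>
    hY.comp (by fun_prop : Continuous fun t : ℝ => (ξ, t))
  have hend : ∀ ξ, ∃ n, (stepState S (ξ, 0, Y ξ 0) n).2.1 = b := by
    intro ξ
    obtain ⟨h0, -, K, hK, hKg⟩ := hε ξ
    exact exists_stepState_time_eq S hS hb ξ
      (hV.comp (by fun_prop : Continuous fun q : ℝ × E => (ξ, q.1, q.2))) hK
      (hYξ ξ).continuousOn (hYV ξ) h0.le hKg
  have hq0 : Continuous fun ξ => (ξ, (0 : ℝ), Y ξ 0) :=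
    continuous_id.prodMk (continuous_const.prodMk
      (hY.comp (by fun_prop : Continuous fun ξ : X => (ξ, (0 : ℝ)))))
  have hcont : ∀ n, Continuous fun ξ => stepState S (ξ, 0, Y ξ 0) n := fun n =>
    (continuous_stepState S n).comp hq0
  refine ⟨fun n ξ => (stepState S (ξ, 0, Y ξ 0) n).2.1, fun n => (S n).control,
    fun n => continuous_fst.comp (continuous_snd.comp (hcont n)), fun ξ => rfl,
    fun ξ => stepState_time_mono S _, fun n ξ => stepState_time_le S hb n, fun ξ₀ => ?_,
    fun ξ => ?_⟩
  · obtain ⟨n, hn⟩ := hend ξ₀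
    -- For `ξ₀` all later states are equal to this one. At a later occurrence `k` of `S₀`, the state
    -- for nearby `ξ` is still near it and its time exceeds `b - η`, so step `k` ends exactly at
    -- `b`.
    obtain ⟨S₀, hfreq, η, hη, hev⟩ := hS (stepState S (ξ₀, 0, Y ξ₀ 0) n)
    obtain ⟨k, hnk, hk⟩ := frequently_atTop.1 hfreq n
    have hkn := stepState_eq_of_time_eq S hn hnk
    refine ⟨k + 1, ?_⟩
    have h1 := (hcont k).tendsto ξ₀
    rw [hkn] at h1
    have h2 : Tendsto (fun ξ => (stepState S (ξ, 0, Y ξ 0) k).2.1) (𝓝 ξ₀) (𝓝 b) := by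
      have := (continuous_fst.tendsto _).comp ((continuous_snd.tendsto _).comp h1)
      rwa [hn] at this
    filter_upwards [h1.eventually hev, h2.eventually (lt_mem_nhds (sub_lt_self b hη))]
      with ξ h3 h4
    refine le_antisymm (stepState_time_le S hb _) ?_
    have h5 := h3 (stepState_time_le S hb _)
    rw [← hk, min_eq_left (by linarith)] at h5
    exact h5
  · obtain ⟨n, hn⟩ := hend ξ
    obtain ⟨Z, hZc, hZn, hZ⟩ := exists_curve S (ξ, 0, Y ξ 0) n
    rw [hn] at hZc
    refine ⟨Z, hZc, hZn 0 (Nat.zero_le n), fun k t ht => ?_⟩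
    rcases lt_or_ge k n with hk | hk
    · exact ⟨(hZ k hk t ht).1, (hZ k hk t ht).2.trans_le (hε ξ).2.1⟩
    · beta_reduce at ht
      rw [stepState_eq_of_time_eq S hn hk, stepState_eq_of_time_eq S hn (hk.trans k.le_succ)] at ht
      exact absurd ht.1 (not_le.2 ht.2)

end Steering

/-! ### Regularity of the triangular field and of the reference family. -/

section Field

variable {ν : ℕ} {m : ℕ → ℕ} {t₀ t₁ T : ℝ} {f : TriangularField m}

theorem dist_snoc_le {n : ℕ} (z z' : Blocks m n) (v : Block m n) (k : Fin (n + 1)) :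
    dist (Fin.snoc (α := fun j : Fin (n + 1) => Block m j) z v k)
      (Fin.snoc (α := fun j : Fin (n + 1) => Block m j) z' v k) ≤ dist z z' := by
  refine Fin.lastCases ?_ (fun j => ?_) k
  · simp only [Fin.snoc_last, dist_self, dist_nonneg]
  · simp only [Fin.snoc_castSucc]
    exact dist_le_pi_dist z z' j

theorem norm_snoc_le {n : ℕ} {z : Blocks m n} {v : Block m n} {R : ℝ} (hz : ‖z‖ ≤ R)
    (hv : ‖v‖ ≤ R) (k : Fin (n + 1)) :
    ‖Fin.snoc (α := fun j : Fin (n + 1) => Block m j) z v k‖ ≤ R := by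
  refine Fin.lastCases ?_ (fun j => ?_) k
  · simpa only [Fin.snoc_last] using hv
  · simp only [Fin.snoc_castSucc]
    exact (norm_le_pi_norm z j).trans hz

theorem continuous_snoc {n : ℕ} (k : Fin (n + 1)) :
    Continuous fun q : Blocks m n × Block m n =>
      Fin.snoc (α := fun j : Fin (n + 1) => Block m j) q.1 q.2 k := by
  refine Fin.lastCases ?_ (fun j => ?_) k
  · simp only [Fin.snoc_last]
    exact continuous_snd
  · simp only [Fin.snoc_castSucc]
    exact (continuous_apply j).comp continuous_fst

theorem subsystemField_last (p : ℕ) (t : ℝ) (y : Blocks m (p + 1)) (v : Block m (p + 1)) :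
    subsystemField f p t y v (Fin.last p) = f p t y v := by
  have h : Fin.snoc (α := fun j : Fin (p + 2) => Block m j) y v (Fin.last (p + 1)) = v :=
    Fin.snoc_last (α := fun j : Fin (p + 2) => Block m j) v y
  change f p t y (Fin.snoc (α := fun j : Fin (p + 2) => Block m j) y v (Fin.last (p + 1))) = _
  rw [h]

theorem subsystemField_castSucc (p : ℕ) (t : ℝ) (y : Blocks m (p + 1)) (v : Block m (p + 1))
    (i : Fin p) :
    subsystemField f p t y v i.castSucc = f i t (truncBlocks y i.castSucc) (y i.succ) := by
  have h : Fin.snoc (α := fun j : Fin (p + 2) => Block m j) y v i.succ.castSucc = y i.succ :=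
    Fin.snoc_castSucc (α := fun j : Fin (p + 2) => Block m j) v y i.succ
  change f i t (truncBlocks y i.castSucc)
    (Fin.snoc (α := fun j : Fin (p + 2) => Block m j) y v i.succ.castSucc) = _
  rw [h]

namespace IsTriangularSystem

open Metric

/-- The derivative is bounded on the compact set `Icc t₀ T ×ˢ closedBall 0 R`, and balls are convex.
-/
theorem exists_lipschitzOnWith (hf : IsTriangularSystem ν m t₀ T f) {i : ℕ} (hi : i < ν)
    (R : ℝ) : ∃ K : NNReal, ∀ t ∈ Icc t₀ T, LipschitzOnWith K
      (fun w : Blocks m (i + 1) × Block m (i + 1) => f i t w.1 w.2) (closedBall 0 R) := by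
  obtain ⟨C, hC⟩ := (isCompact_Icc.prod (isCompact_closedBall
    (0 : Blocks m (i + 1) × Block m (i + 1)) R)).exists_bound_of_continuousOn
    ((hf.continuousOn_fderiv i hi).mono (prod_mono_right (subset_univ _)))
  refine ⟨C.toNNReal, fun t ht => (convex_closedBall _ _).lipschitzOnWith_of_nnnorm_fderiv_le
    (𝕜 := ℝ) (fun w _ => hf.differentiable i hi t ht w) fun w hw => ?_⟩
  rw [← NNReal.coe_le_coe, coe_nnnorm]
  exact (hC (t, w) ⟨ht, hw⟩).trans (Real.le_coe_toNNReal C)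

theorem exists_lipschitzOnWith_subsystemField (hf : IsTriangularSystem ν m t₀ T f) {p : ℕ}
    (hp : p < ν) (R : ℝ) : ∃ K : NNReal, ∀ t ∈ Icc t₀ T, ∀ v ∈ closedBall (0 : Block m (p + 1)) R,
      LipschitzOnWith K (fun z => subsystemField f p t z v) (closedBall 0 R) := by
  choose K hK using fun i : Fin (p + 1) =>
    hf.exists_lipschitzOnWith (i := i) ((Nat.lt_succ_iff.1 i.2).trans_lt hp) R
  refine ⟨Finset.univ.sup K, fun t ht v hv => LipschitzOnWith.of_dist_le_mul
    fun z hz z' hz' => (dist_pi_le_iff (by positivity)).2 fun i => ?_⟩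
  rw [mem_closedBall_zero_iff] at hz hz' hv
  have hmem : ∀ z : Blocks m (p + 1), ‖z‖ ≤ R →
      ((truncBlocks z i, Fin.snoc (α := fun j : Fin (p + 2) => Block m j) z v i.succ) :
        Blocks m (i + 1) × Block m (i + 1)) ∈ closedBall 0 R := by
    intro z hz
    rw [mem_closedBall_zero_iff, Prod.norm_def]
    exact max_le ((pi_norm_le_iff_of_nonneg ((norm_nonneg z).trans hz)).2 fun j =>
      (norm_le_pi_norm z _).trans hz) (norm_snoc_le hz hv i.succ)
  refine ((hK i t ht).dist_le_mul _ (hmem z hz) _ (hmem z' hz')).trans ?_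
  refine mul_le_mul (NNReal.coe_le_coe.2 (Finset.le_sup (Finset.mem_univ i))) ?_ dist_nonneg
    (NNReal.coe_nonneg _)
  rw [Prod.dist_eq]
  exact max_le ((dist_pi_le_iff dist_nonneg).2 fun j => dist_le_pi_dist z z' _)
    (dist_snoc_le z z' v i.succ)

theorem continuousOn_subsystemField (hf : IsTriangularSystem ν m t₀ T f) {p : ℕ} (hp : p < ν) :
    ContinuousOn (fun q : ℝ × Blocks m (p + 1) × Block m (p + 1) =>
      subsystemField f p q.1 q.2.1 q.2.2) (Icc t₀ T ×ˢ univ) := by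
  refine continuousOn_pi.2 fun i => ?_
  have hs := (continuous_snoc (m := m) (n := p + 1) i.succ)
  have hg : Continuous fun q : ℝ × Blocks m (p + 1) × Block m (p + 1) =>
      ((q.1, truncBlocks q.2.1 i,
        Fin.snoc (α := fun j : Fin (p + 2) => Block m j) q.2.1 q.2.2 i.succ) :
        ℝ × Blocks m (i + 1) × Block m (i + 1)) := by
    refine continuous_fst.prodMk (Continuous.prodMk ?_ (hs.comp continuous_snd))
    exact continuous_pi fun j => (continuous_apply _).comp (continuous_fst.comp continuous_snd)
  exact (hf.continuousOn i ((Nat.lt_succ_iff.1 i.2).trans_lt hp)).comp hg.continuousOn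
    fun q hq => ⟨hq.1, mem_univ _⟩

end IsTriangularSystem

/-- Turns the function-space continuity of the reference family into joint continuity. The map `g`
into `A` will be a projection onto the time interval, which extends the family to all times. -/
theorem continuous_of_tendstoUniformlyOn {X Y F : Type*} [TopologicalSpace X]
    [TopologicalSpace Y] [PseudoMetricSpace F] {A : Set ℝ} {x : X → ℝ → F} {g : Y → ℝ}
    (hc : ∀ ξ, ContinuousOn (x ξ) A) (hu : ∀ ξ₀, TendstoUniformlyOn x (x ξ₀) (𝓝 ξ₀) A)
    (hg : Continuous g) (hgA : ∀ s, g s ∈ A) : Continuous fun q : X × Y => x q.1 (g q.2) := by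
  refine continuous_iff_continuousAt.2 fun q₀ => Metric.tendsto_nhds.2 fun ε hε => ?_
  have h1 := (continuous_fst.tendsto q₀).eventually
    (Metric.tendstoUniformlyOn_iff.1 (hu q₀.1) (ε / 2) (half_pos hε))
  have h2 : Continuous fun s => x q₀.1 (g s) := (hc q₀.1).comp_continuous hg hgA
  have h3 := (h2.comp continuous_snd).tendsto q₀ |>.eventually
    (Metric.ball_mem_nhds _ (half_pos hε))
  filter_upwards [h1, h3] with q hq1 hq3
  have h4 := hq1 (g q.2) (hgA q.2)
  have h5 : dist (x q₀.1 (g q.2)) (x q₀.1 (g q₀.2)) < ε / 2 := hq3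
  rw [dist_comm] at h4
  linarith [dist_triangle (x q.1 (g q.2)) (x q₀.1 (g q.2)) (x q₀.1 (g q₀.2))]

/-- The field of the first `p` equations, with a prescribed velocity of the last block. -/
def prescribedField (f : TriangularField m) (p : ℕ) (t : ℝ) (w : Block m p)
    (z : Blocks m (p + 1)) : Blocks m (p + 1) :=
  Function.update (subsystemField f p t z 0) (Fin.last p) w

/-- The control enters only the last equation. So the placeholder control `0` in `prescribedField`
is harmless, and the whole discrepancy of the two fields is the error in the last block. -/
theorem subsystemField_sub_prescribedField (p : ℕ) (t : ℝ) (w : Block m p)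
    (z : Blocks m (p + 1)) (v : Block m (p + 1)) :
    subsystemField f p t z v - prescribedField f p t w z = Pi.single (Fin.last p) (f p t z v - w) := by
  funext i
  refine Fin.lastCases ?_ (fun j => ?_) i
  · rw [Pi.sub_apply, subsystemField_last, prescribedField, Function.update_self, Pi.single_eq_same]
  · have hj : j.castSucc ≠ Fin.last p := (Fin.castSucc_lt_last j).ne
    rw [Pi.sub_apply, prescribedField, Function.update_of_ne hj, subsystemField_castSucc,
      subsystemField_castSucc, sub_self, Pi.single_eq_of_ne hj]

namespace IsReferenceFamily

variable {p : ℕ} {xs zs : (j : ℕ) → Block m j} {y : Blocks m (p + 1) → ℝ → Blocks m (p + 1)}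

theorem hasDerivWithinAt (hy : IsReferenceFamily f p t₁ T xs zs y) (ξ : Blocks m (p + 1)) {t : ℝ}
    (ht : t ∈ Icc t₁ T) :
    HasDerivWithinAt (y ξ) (prescribedField f p t
      (derivWithin (fun s => y ξ s (Fin.last p)) (Icc t₁ T) t) (y ξ t)) (Icc t₁ T) t := by
  refine hasDerivWithinAt_pi.2 fun i => ?_
  have h := ((((hy.c1_family i).1 ξ).differentiableOn one_ne_zero) t ht).hasDerivWithinAt
  convert h using 1
  revert h
  refine Fin.lastCases (fun _ => ?_) (fun j _ => ?_) i
  · rw [prescribedField, Function.update_self]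
  · have hj : j.castSucc ≠ Fin.last p := (Fin.castSucc_lt_last j).ne
    rw [prescribedField, Function.update_of_ne hj, subsystemField_castSucc]
    exact (hy.equations ξ j t ht).symm

theorem continuous_comp (hy : IsReferenceFamily f p t₁ T xs zs y) {g : ℝ → ℝ} (hg : Continuous g)
    (hgJ : ∀ s, g s ∈ Icc t₁ T) :
    Continuous fun q : Blocks m (p + 1) × ℝ => y q.1 (g q.2) :=
  continuous_pi fun i => continuous_of_tendstoUniformlyOn (x := fun ξ t => y ξ t i)
    (fun ξ => ((hy.c1_family i).1 ξ).continuousOn) (fun ξ => ((hy.c1_family i).2 ξ).1) hg hgJ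

theorem continuous_derivWithin_comp (hy : IsReferenceFamily f p t₁ T xs zs y) (hJ : t₁ < T)
    {g : ℝ → ℝ} (hg : Continuous g) (hgJ : ∀ s, g s ∈ Icc t₁ T) :
    Continuous fun q : Blocks m (p + 1) × ℝ =>
      (derivWithin (fun s => y q.1 s (Fin.last p)) (Icc t₁ T) (g q.2) : Block m p) :=
  continuous_of_tendstoUniformlyOn
    (x := fun ξ => derivWithin (fun s => y ξ s (Fin.last p)) (Icc t₁ T))
    (fun ξ => ((hy.c1_family (Fin.last p)).1 ξ).continuousOn_derivWithin
      (uniqueDiffOn_Icc hJ) le_rfl)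
    (fun ξ => ((hy.c1_family (Fin.last p)).2 ξ).2) hg hgJ

end IsReferenceFamily

end Field

/-! ### Controls given by switching times: piecewise constancy, `L₁` continuity, `L_∞` bounds. -/

section Switching

variable {F : Type*} {a T : ℝ}

/-- The case `a = b` is allowed and adds no node: steps of zero duration produce repeated switching
times, but the partition must be strict. -/
theorem IsPiecewiseConstantOn.cons {v : ℝ → F} {b c : ℝ} (h : IsPiecewiseConstantOn v b c)
    (hab : a ≤ b) {u : F} (hu : ∀ t ∈ Ioo a b, v t = u) : IsPiecewiseConstantOn v a c := by
  rcases hab.eq_or_lt with rfl | hab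
  · exact h
  obtain ⟨N, s, hs, hs0, hsN, hv⟩ := h
  refine ⟨N + 1, Fin.cons a s, ?_, Fin.cons_zero .., ?_, fun j => ?_⟩
  · refine Fin.strictMono_iff_lt_succ.2 fun i => ?_
    refine Fin.cases ?_ (fun j => ?_) i
    · simpa [hs0] using hab
    · rw [Fin.castSucc_succ, Fin.cons_succ, Fin.cons_succ]
      exact hs j.castSucc_lt_succ
  · rw [← Fin.succ_last, Fin.cons_succ, hsN]
  · refine Fin.cases ?_ (fun j => ?_) j
    · refine ⟨u, fun t ht => hu t ?_⟩
      simpa [hs0] using ht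
    · obtain ⟨c, hc⟩ := hv j
      refine ⟨c, fun t ht => hc t ?_⟩
      rwa [Fin.castSucc_succ, Fin.cons_succ, Fin.cons_succ] at ht

theorem isPiecewiseConstantOn_of_switching {v : ℝ → F} {u : ℕ → F} {τ : ℕ → ℝ} (hτ : Antitone τ)
    (hv : ∀ n, ∀ t ∈ Ioc (τ (n + 1)) (τ n), v t = u n) (n : ℕ) :
    IsPiecewiseConstantOn v (τ n) (τ 0) := by
  induction n with
  | zero =>
    exact ⟨0, fun _ => τ 0, fun i j hij => absurd hij (by omega), rfl, rfl, fun j => j.elim0⟩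
  | succ n ih =>
    exact ih.cons (hτ n.le_succ) fun t ht => hv n t ⟨ht.1, ht.2.le⟩

theorem exists_mem_Ioc_succ {τ : ℕ → ℝ} {t : ℝ} {n : ℕ} (h₀ : t ≤ τ 0) (hn : τ n < t) :
    ∃ k < n, t ∈ Ioc (τ (k + 1)) (τ k) := by
  induction n with
  | zero => exact absurd h₀ (not_le.2 hn)
  | succ n ih =>
    by_cases h : τ n < t
    · obtain ⟨k, hk, hkt⟩ := ih h
      exact ⟨k, by omega, hkt⟩
    · exact ⟨n, by omega, hn, not_lt.1 h⟩

theorem eq_of_mem_Ioc_succ {τ : ℕ → ℝ} (hτ : Antitone τ) {t : ℝ} {j k : ℕ}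
    (hj : t ∈ Ioc (τ (j + 1)) (τ j)) (hk : t ∈ Ioc (τ (k + 1)) (τ k)) : j = k := by
  rcases lt_trichotomy j k with h | h | h
  · exact absurd (hk.2.trans (hτ (Nat.succ_le_of_lt h))) (not_le.2 hj.1)
  · exact h
  · exact absurd (hj.2.trans (hτ (Nat.succ_le_of_lt h))) (not_le.2 hk.1)

/-- There is a control with prescribed values between given switching times and a prescribed value
elsewhere. -/
theorem exists_switching_control {τ : ℕ → ℝ} (hτ : Antitone τ) (u : ℕ → F) (c : F) :
    ∃ v : ℝ → F, (∀ n, ∀ t ∈ Ioc (τ (n + 1)) (τ n), v t = u n) ∧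
      ∀ t, (∀ n, t ∉ Ioc (τ (n + 1)) (τ n)) → v t = c := by
  classical
  refine ⟨fun t => if h : ∃ n, t ∈ Ioc (τ (n + 1)) (τ n) then u h.choose else c,
    fun n t ht => ?_, fun t ht => dif_neg (not_exists.2 ht)⟩
  have h : ∃ n, t ∈ Ioc (τ (n + 1)) (τ n) := ⟨n, ht⟩
  simp only [dif_pos h]
  rw [eq_of_mem_Ioc_succ hτ h.choose_spec ht]

variable [NormedAddCommGroup F]

theorem ae_restrict_Icc_exists_mem_Ioc {τ : ℕ → ℝ} {N : ℕ} (hτN : τ N = a) :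
    ∀ᵐ t ∂volume.restrict (Icc a (τ 0)), ∃ k < N, t ∈ Ioc (τ (k + 1)) (τ k) := by
  rw [← restrict_Ioc_eq_restrict_Icc]
  filter_upwards [ae_restrict_mem measurableSet_Ioc] with t ht
  exact exists_mem_Ioc_succ ht.2 (hτN ▸ ht.1)

/-- The half-open intervals are disjoint and miss only the endpoint `a`, a null set. -/
theorem ae_eq_sum_indicator {v : ℝ → F} {u : ℕ → F} {τ : ℕ → ℝ} (hτ : Antitone τ)
    (hv : ∀ n, ∀ t ∈ Ioc (τ (n + 1)) (τ n), v t = u n) {N : ℕ} (hτN : τ N = a) :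
    v =ᵐ[volume.restrict (Icc a (τ 0))]
      fun t => ∑ n ∈ Finset.range N, (Ioc (τ (n + 1)) (τ n)).indicator (fun _ => u n) t := by
  filter_upwards [ae_restrict_Icc_exists_mem_Ioc hτN] with t ht
  obtain ⟨k, hk, hkt⟩ := ht
  rw [Finset.sum_eq_single k, indicator_of_mem hkt, hv k t hkt]
  · intro n _ hn
    exact indicator_of_notMem (fun h => hn (eq_of_mem_Ioc_succ hτ h hkt)) _
  · exact fun h => absurd (Finset.mem_range.2 hk) h

theorem volume_symmDiff_Ioc_le (a b c d : ℝ) :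
    volume (symmDiff (Ioc a b) (Ioc c d)) ≤ ENNReal.ofReal (|c - a| + |d - b|) := by
  have hsub : symmDiff (Ioc a b) (Ioc c d) ⊆ uIcc a c ∪ uIcc b d := by
    rintro t (⟨⟨h1, h2⟩, h3⟩ | ⟨⟨h1, h2⟩, h3⟩)
    · by_cases h : t ≤ c
      · exact Or.inl (mem_uIcc.2 (Or.inl ⟨h1.le, h⟩))
      · refine Or.inr (mem_uIcc.2 (Or.inr ⟨?_, h2⟩))
        by_contra h'
        exact h3 ⟨not_le.1 h, (not_le.1 h').le⟩
    · by_cases h : t ≤ a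
      · exact Or.inl (mem_uIcc.2 (Or.inr ⟨h1.le, h⟩))
      · refine Or.inr (mem_uIcc.2 (Or.inl ⟨?_, h2⟩))
        by_contra h'
        exact h3 ⟨not_le.1 h, (not_le.1 h').le⟩
  calc volume (symmDiff (Ioc a b) (Ioc c d)) ≤ volume (uIcc a c ∪ uIcc b d) := measure_mono hsub
    _ ≤ volume (uIcc a c) + volume (uIcc b d) := measure_union_le _ _
    _ = _ := by rw [Real.volume_interval, Real.volume_interval, ENNReal.ofReal_add (abs_nonneg _)
      (abs_nonneg _)]

theorem memLp_of_switching {v : ℝ → F} {u : ℕ → F} {τ : ℕ → ℝ} (hτ : Antitone τ)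
    (hv : ∀ n, ∀ t ∈ Ioc (τ (n + 1)) (τ n), v t = u n) {N : ℕ} (hτN : τ N = a) (r : ENNReal) :
    MemLp v r (volume.restrict (Icc a (τ 0))) :=
  (memLp_congr_ae (ae_eq_sum_indicator hτ hv hτN)).2 <| memLp_finsetSum _ fun _ _ =>
    memLp_indicator_const r measurableSet_Ioc _ (Or.inr (measure_ne_top _ _))

/-- A piecewise constant control with locally finitely many values depends continuously in `L₁` on
a parameter if its switching times do. -/
theorem continuous_toLp_of_switching {X : Type*} [TopologicalSpace X] {v : X → ℝ → F} {u : ℕ → F}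
    {τ : ℕ → X → ℝ} (hτ : ∀ ξ, Antitone fun n => τ n ξ) (hτc : ∀ n, Continuous (τ n))
    (hτ0 : ∀ ξ, τ 0 ξ = T) (hτN : ∀ ξ₀, ∃ N, ∀ᶠ ξ in 𝓝 ξ₀, τ N ξ = a)
    (hv : ∀ ξ n, ∀ t ∈ Ioc (τ (n + 1) ξ) (τ n ξ), v ξ t = u n)
    (hmem : ∀ ξ, MemLp (v ξ) 1 (volume.restrict (Icc a T))) :
    Continuous fun ξ => (hmem ξ).toLp (v ξ) := by
  have hpiece : ∀ n, Continuous fun ξ => indicatorConstLp 1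
      (measurableSet_Ioc (a := τ (n + 1) ξ) (b := τ n ξ))
      (measure_ne_top (volume.restrict (Icc a T)) _) (u n) := by
    intro n
    refine continuous_indicatorConstLp_set ENNReal.one_ne_top fun ξ₀ => ?_
    have hlim : Tendsto (fun ξ => ENNReal.ofReal (|τ (n + 1) ξ₀ - τ (n + 1) ξ| + |τ n ξ₀ - τ n ξ|))
        (𝓝 ξ₀) (𝓝 0) := by
      have h1 := hτc n
      have h2 := hτc (n + 1)
      have : Continuous fun ξ =>
          ENNReal.ofReal (|τ (n + 1) ξ₀ - τ (n + 1) ξ| + |τ n ξ₀ - τ n ξ|) :=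
        ENNReal.continuous_ofReal.comp (by fun_prop)
      simpa using this.tendsto ξ₀
    exact tendsto_of_tendsto_of_tendsto_of_le_of_le tendsto_const_nhds hlim (fun _ => zero_le)
      fun ξ => (Measure.restrict_apply_le _ _).trans (volume_symmDiff_Ioc_le _ _ _ _)
  refine continuous_iff_continuousAt.2 fun ξ₀ => ?_
  obtain ⟨N, hN⟩ := hτN ξ₀
  have hsum : Continuous fun ξ => ∑ n ∈ Finset.range N, indicatorConstLp 1
      (measurableSet_Ioc (a := τ (n + 1) ξ) (b := τ n ξ))
      (measure_ne_top (volume.restrict (Icc a T)) _) (u n) :=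
    continuous_finsetSum _ fun n _ => hpiece n
  -- Near `ξ₀` the same `N` works for all `ξ`, so the control is a sum of a fixed number of
  -- indicators, each continuous in `L₁` because its interval moves continuously in measure.
  refine hsum.continuousAt.congr ?_
  filter_upwards [hN] with ξ hξ
  refine Lp.ext ?_
  have h1 := ae_eq_sum_indicator (hτ ξ) (hv ξ) hξ
  simp only [hτ0] at h1
  refine EventuallyEq.trans ?_ (h1.symm.trans (hmem ξ).coeFn_toLp.symm)
  refine (Lp.coeFn_finsetSum _ _).trans ?_
  have h2 : ∀ᵐ t ∂volume.restrict (Icc a T), ∀ n : ℕ, indicatorConstLp 1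
      (measurableSet_Ioc (a := τ (n + 1) ξ) (b := τ n ξ))
      (measure_ne_top (volume.restrict (Icc a T)) _) (u n) t =
        (Ioc (τ (n + 1) ξ) (τ n ξ)).indicator (fun _ => u n) t :=
    ae_all_iff.2 fun n => indicatorConstLp_coeFn
  filter_upwards [h2] with t ht
  simp only [Finset.sum_apply, ht]

theorem eLpNorm_top_le_of_switching {v : ℝ → F} {u : ℕ → F} {τ : ℕ → ℝ} {M : ℝ} {N : ℕ}
    (hτN : τ N = a) (hv : ∀ n, ∀ t ∈ Ioc (τ (n + 1)) (τ n), v t = u n)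
    (hM : ∀ n, τ (n + 1) < τ n → ‖u n‖ ≤ M) :
    eLpNorm v ⊤ (volume.restrict (Icc a (τ 0))) ≤ ENNReal.ofReal M := by
  rw [eLpNorm_exponent_top]
  refine eLpNormEssSup_le_of_ae_bound ?_
  filter_upwards [ae_restrict_Icc_exists_mem_Ioc hτN] with t ht
  obtain ⟨k, -, hk⟩ := ht
  rw [hv k t hk]
  exact hM k (hk.1.trans_le hk.2)

end Switching

/-! ### Time reversal: Carathéodory trajectories and right derivatives. -/

section Trajectory

section Abstract

theorem intervalIntegrable_reflect {E : Type*} [NormedAddCommGroup E] {g : ℝ → E} {T t : ℝ} (htT : t ≤ T)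
    (hg : IntegrableOn g (Icc t T)) :
    IntervalIntegrable (fun r => -g (T - r)) volume 0 (T - t) := by
  have h := ((((intervalIntegrable_iff_integrableOn_Icc_of_le htT).2 hg).symm).comp_sub_left T).neg
  rwa [sub_self] at h

variable {E U : Type*} [NormedAddCommGroup E] [NormedSpace ℝ E]

open Metric in
-- On each switching interval the field is Lipschitz on a ball containing both curves, and the
-- common value at the end of one interval is the initial value for the next.
theorem eqOn_of_switching {F : ℝ → E → U → E} {u : ℕ → U} {σ : ℕ → ℝ} {b : ℝ} {Z Z' : ℝ → E}
    (hFlip : ∀ u, ∀ R : ℝ, ∃ K : NNReal, ∀ t,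
      LipschitzOnWith K (fun z => F t z u) (closedBall 0 R))
    (hσ : Monotone σ) (hσ0 : σ 0 = 0) (hσb : ∀ n, σ n ≤ b)
    (hZ : ContinuousOn Z (Icc 0 b)) (hZ' : ContinuousOn Z' (Icc 0 b)) (h0 : Z 0 = Z' 0)
    (hZd : ∀ n, ∀ t ∈ Ico (σ n) (σ (n + 1)), HasDerivWithinAt Z (F t (Z t) (u n)) (Ici t) t)
    (hZd' : ∀ n, ∀ t ∈ Ico (σ n) (σ (n + 1)), HasDerivWithinAt Z' (F t (Z' t) (u n)) (Ici t) t)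
    (n : ℕ) : EqOn Z Z' (Icc 0 (σ n)) := by
  obtain ⟨R, hR⟩ := isCompact_Icc.exists_bound_of_continuousOn hZ
  obtain ⟨R', hR'⟩ := isCompact_Icc.exists_bound_of_continuousOn hZ'
  have hpos : ∀ n, 0 ≤ σ n := fun n => hσ0 ▸ hσ (Nat.zero_le n)
  induction n with
  | zero =>
    rw [hσ0, Icc_self]
    rintro _ rfl
    exact h0
  | succ n ih =>
    obtain ⟨K, hK⟩ := hFlip (u n) (max R R')
    have hsub : Icc (σ n) (σ (n + 1)) ⊆ Icc 0 b := Icc_subset_Icc (hpos n) (hσb _)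
    have key := ODE_solution_unique_of_mem_Icc_right (s := fun _ => closedBall 0 (max R R'))
      (v := fun t z => F t z (u n)) (fun t _ => hK t) (hZ.mono hsub) (hZd n)
      (fun t ht => mem_closedBall_zero_iff.2 ((hR t (hsub ⟨ht.1, ht.2.le⟩)).trans (le_max_left _ _)))
      (hZ'.mono hsub) (hZd' n)
      (fun t ht => mem_closedBall_zero_iff.2
        ((hR' t (hsub ⟨ht.1, ht.2.le⟩)).trans (le_max_right _ _)))
      (ih ⟨hpos n, le_rfl⟩)
    rw [← Icc_union_Icc_eq_Icc (hpos n) (hσ n.le_succ)]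
    exact ih.union key

theorem hasDerivWithinAt_Ici_of_eq_integral [CompleteSpace E] {Z g : ℝ → E} {η : E} {b s : ℝ}
    (hZ : ∀ s ∈ Icc 0 b, Z s = η + ∫ r in (0 : ℝ)..s, g r)
    (hg : IntervalIntegrable g volume 0 b) (hs : s ∈ Ico 0 b)
    (hgc : ContinuousWithinAt g (Ioi s) s) : HasDerivWithinAt Z (g s) (Ici s) s := by
  have hb : (0 : ℝ) ≤ b := hs.1.trans hs.2.le
  have hint : IntervalIntegrable g volume 0 s :=
    hg.mono_set (by rw [uIcc_of_le hs.1, uIcc_of_le hb]; exact Icc_subset_Icc_right hs.2.le)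
  have hmeas : StronglyMeasurableAtFilter g (𝓝[>] s) volume :=
    ⟨Ioc s b, Ioc_mem_nhdsGT hs.2, (hg.1.mono_set (Ioc_subset_Ioc_left hs.1)).aestronglyMeasurable⟩
  have h := (intervalIntegral.integral_hasDerivWithinAt_right (s := Ici s) (t := Ioi s)
    hint hmeas hgc).const_add η
  refine h.congr_of_eventuallyEq ?_ (hZ s ⟨hs.1, hs.2.le⟩)
  filter_upwards [Icc_mem_nhdsGE hs.2] with r hr using hZ r ⟨hs.1.trans hr.1, hr.2⟩

theorem integral_reflect (g : ℝ → E) (T t : ℝ) :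
    ∫ s in T..t, g s = ∫ r in (0 : ℝ)..(T - t), -g (T - r) := by
  rw [intervalIntegral.integral_neg, intervalIntegral.integral_comp_sub_left g T, sub_zero,
    sub_sub_cancel, intervalIntegral.integral_symm]

end Abstract

variable {ν : ℕ} {m : ℕ → ℕ} {t₀ t₁ T : ℝ} {f : TriangularField m} {p : ℕ}

/-- The right-hand side of the first `p + 1` equations in reversed time, started at `T` and frozen
outside of the time interval. -/
noncomputable def reversedField (f : TriangularField m) (p : ℕ) (hJ : t₁ ≤ T) (s : ℝ)
    (z : Blocks m (p + 1)) (v : Block m (p + 1)) : Blocks m (p + 1) :=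
  -subsystemField f p (projIcc t₁ T hJ (T - s)) z v

theorem projIcc_sub_of_mem (hJ : t₁ ≤ T) {s : ℝ} (hs : s ∈ Icc 0 (T - t₁)) :
    (projIcc t₁ T hJ (T - s) : ℝ) = T - s := by
  rw [projIcc_of_mem hJ (show T - s ∈ Icc t₁ T from ⟨by linarith [hs.2], by linarith [hs.1]⟩)]

theorem reversedField_of_mem (hJ : t₁ ≤ T) {s : ℝ} (hs : s ∈ Icc 0 (T - t₁))
    (z : Blocks m (p + 1)) (v : Block m (p + 1)) :
    reversedField f p hJ s z v = -subsystemField f p (T - s) z v := by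
  rw [reversedField, projIcc_sub_of_mem hJ hs]

theorem continuous_reversedField (hf : IsTriangularSystem ν m t₀ T f) (hp : p < ν) (ht : t₀ ≤ t₁)
    (hJ : t₁ ≤ T) : Continuous fun q : ℝ × Blocks m (p + 1) × Block m (p + 1) =>
      reversedField f p hJ q.1 q.2.1 q.2.2 := by
  have hg : Continuous fun q : ℝ × Blocks m (p + 1) × Block m (p + 1) =>
      ((projIcc t₁ T hJ (T - q.1) : ℝ), q.2.1, q.2.2) :=
    (continuous_subtype_val.comp (continuous_projIcc.comp (by fun_prop))).prodMk (by fun_prop)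
  exact ((hf.continuousOn_subsystemField hp).comp_continuous hg fun q =>
    ⟨Icc_subset_Icc_left ht (projIcc t₁ T hJ _).2, mem_univ _⟩).neg

theorem continuousOn_reversedField_comp (hf : IsTriangularSystem ν m t₀ T f) (hp : p < ν)
    (ht : t₀ ≤ t₁) (hJ : t₁ ≤ T) {Z : ℝ → Blocks m (p + 1)} {A : Set ℝ} (hZ : ContinuousOn Z A)
    (w : Block m (p + 1)) : ContinuousOn (fun s => reversedField f p hJ s (Z s) w) A := by
  have h : ContinuousOn (fun s : ℝ => (s, Z s, w)) A :=
    continuousOn_id.prodMk (hZ.prodMk continuousOn_const)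
  have h' := (continuous_reversedField hf hp ht hJ).comp_continuousOn h
  exact h'

open Metric in
theorem exists_lipschitzOnWith_reversedField (hf : IsTriangularSystem ν m t₀ T f) (hp : p < ν)
    (ht : t₀ ≤ t₁) (hJ : t₁ ≤ T) (v : Block m (p + 1)) (R : ℝ) : ∃ K : NNReal, ∀ s,
      LipschitzOnWith K (fun z => reversedField f p hJ s z v) (closedBall 0 R) := by
  obtain ⟨K, hK⟩ := hf.exists_lipschitzOnWith_subsystemField hp (max R ‖v‖)
  refine ⟨K, fun s => LipschitzOnWith.of_dist_le_mul fun z hz z' hz' => ?_⟩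
  rw [reversedField, reversedField, dist_neg_neg]
  exact ((hK _ (Icc_subset_Icc_left ht (projIcc t₁ T hJ _).2) v
    (mem_closedBall_zero_iff.2 (le_max_right _ _))).mono
      (closedBall_subset_closedBall (le_max_left _ _))).dist_le_mul z hz z' hz'

variable {σ : ℕ → ℝ} {u : ℕ → Block m (p + 1)} {v : ℝ → Block m (p + 1)} {ξ : Blocks m (p + 1)}

/-- In reversed time, a trajectory for a piecewise constant control has right derivatives
everywhere. -/
theorem IsTrajectoryOn.hasDerivWithinAt_reflect (hf : IsTriangularSystem ν m t₀ T f) (hp : p < ν)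
    (ht : t₀ ≤ t₁) (hJ : t₁ ≤ T) {z : ℝ → Blocks m (p + 1)}
    (hz : IsTrajectoryOn f p t₁ T T ξ v z) (hσ : Monotone σ) (hσ0 : σ 0 = 0)
    (hσb : ∀ n, σ n ≤ T - t₁)
    (hv : ∀ n, ∀ t ∈ Ioc (T - σ (n + 1)) (T - σ n), v t = u n) (n : ℕ) :
    ∀ s ∈ Ico (σ n) (σ (n + 1)), HasDerivWithinAt (fun s => z (T - s))
      (reversedField f p hJ s (z (T - s)) (u n)) (Ici s) s := by
  intro s hs
  have hs0 : 0 ≤ s := (hσ0 ▸ hσ (Nat.zero_le n) : 0 ≤ σ n).trans hs.1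
  have hsb : s < T - t₁ := hs.2.trans_le (hσb _)
  obtain ⟨g, hgdef⟩ : ∃ g : ℝ → Blocks m (p + 1), g = fun r =>
    -subsystemField f p (T - r) (z (T - r)) (v (T - r)) := ⟨_, rfl⟩
  have hmaps : MapsTo (fun r => T - r) (Icc 0 (T - t₁)) (Icc t₁ T) := fun r hr =>
    ⟨by linarith [hr.2], by linarith [hr.1]⟩
  have hzc : ContinuousOn (fun r => z (T - r)) (Icc 0 (T - t₁)) :=
    hz.continuousOn.comp (by fun_prop) hmaps
  have hg : IntervalIntegrable g volume 0 (T - t₁) := by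
    rw [hgdef]; exact intervalIntegrable_reflect hJ hz.integrableOn
  -- Intervals open on the left in `t` become intervals open on the right in `s`, so the integrand
  -- is right-continuous at every `s`, switching times included.
  have hgr : ∀ r ∈ Ico s (σ (n + 1)), g r = reversedField f p hJ r (z (T - r)) (u n) := by
    intro r hr
    rw [reversedField_of_mem hJ ⟨hs0.trans hr.1, hr.2.le.trans (hσb _)⟩, hgdef]
    simp only
    rw [hv n (T - r) ⟨by linarith [hr.2], by linarith [hs.1, hr.1]⟩]
  have hcont : ContinuousOn (fun r => reversedField f p hJ r (z (T - r)) (u n))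
      (Icc 0 (T - t₁)) :=
    continuousOn_reversedField_comp hf hp ht hJ hzc (u n)
  have hgc : ContinuousWithinAt g (Ioi s) s := by
    have h1 : ContinuousWithinAt (fun r => reversedField f p hJ r (z (T - r)) (u n)) (Ioi s) s :=
      (hcont s ⟨hs0, hsb.le⟩).mono_of_mem_nhdsWithin
        (mem_of_superset (Ioc_mem_nhdsGT hsb) fun r hr => ⟨hs0.trans hr.1.le, hr.2⟩)
    refine h1.congr_of_eventuallyEq ?_ (hgr s ⟨le_rfl, hs.2⟩)
    filter_upwards [Ioo_mem_nhdsGT hs.2] with r hr using hgr r ⟨hr.1.le, hr.2⟩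
  rw [← hgr s ⟨le_rfl, hs.2⟩]
  refine hasDerivWithinAt_Ici_of_eq_integral (η := ξ) (b := T - t₁) (fun r hr => ?_) hg
    ⟨hs0, hsb⟩ hgc
  rw [hz.integral_eq _ (hmaps hr), integral_reflect, sub_sub_cancel, hgdef]

/-- A solution of the reversed equation for a piecewise constant control is a trajectory. -/
theorem isTrajectoryOn_of_switching (hf : IsTriangularSystem ν m t₀ T f) (hp : p < ν)
    (ht : t₀ ≤ t₁) (hJ : t₁ ≤ T) {Z : ℝ → Blocks m (p + 1)} (hσ : Monotone σ) (hσ0 : σ 0 = 0)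
    {N : ℕ} (hσN : σ N = T - t₁)
    (hv : ∀ n, ∀ t ∈ Ioc (T - σ (n + 1)) (T - σ n), v t = u n)
    (hZc : ContinuousOn Z (Icc 0 (T - t₁))) (hZ0 : Z 0 = ξ)
    (hZ : ∀ n, ∀ s ∈ Ico (σ n) (σ (n + 1)),
      HasDerivWithinAt Z (reversedField f p hJ s (Z s) (u n)) (Ici s) s) :
    IsTrajectoryOn f p t₁ T T ξ v (fun t => Z (T - t)) := by
  have hmaps : MapsTo (fun r => T - r) (Icc t₁ T) (Icc 0 (T - t₁)) := fun r hr =>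
    ⟨by linarith [hr.2], by linarith [hr.1]⟩
  have hzc : ContinuousOn (fun t => Z (T - t)) (Icc t₁ T) := hZc.comp (by fun_prop) hmaps
  have hanti : Antitone fun n => T - σ n := fun i j hij => sub_le_sub_left (hσ hij) T
  have hτN : T - σ N = t₁ := by rw [hσN]; ring
  have hτ0 : T - σ 0 = T := by rw [hσ0, sub_zero]
  have hint : IntegrableOn (fun s => subsystemField f p s (Z (T - s)) (v s)) (Icc t₁ T) := by
    have hvm : AEStronglyMeasurable v (volume.restrict (Icc t₁ T)) := by
      have := memLp_of_switching (v := v) hanti hv hτN 1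
      rw [hτ0] at this
      exact this.aestronglyMeasurable
    have hzm : AEStronglyMeasurable (fun t => Z (T - t)) (volume.restrict (Icc t₁ T)) :=
      hzc.aestronglyMeasurable measurableSet_Icc
    obtain ⟨R, hR⟩ := isCompact_Icc.exists_bound_of_continuousOn hzc
    have hcont := continuous_reversedField hf hp ht hJ
    -- Only the first `N` control values occur almost everywhere, so the integrand takes its
    -- arguments in a compact set and is bounded.
    obtain ⟨C, hC⟩ := (isCompact_Icc.prod ((isCompact_closedBall (0 : Blocks m (p + 1)) R).prod
      (Finset.finite_toSet ((Finset.range N).image u)).isCompact)).exists_bound_of_continuousOn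
      (s := Icc 0 (T - t₁) ×ˢ _) hcont.continuousOn
    have hae : ∀ᵐ t ∂volume.restrict (Icc t₁ T), ∃ k < N,
        t ∈ Ioc (T - σ (k + 1)) (T - σ k) := by
      have := ae_restrict_Icc_exists_mem_Ioc (τ := fun n => T - σ n) hτN
      rwa [hτ0] at this
    have heq : ∀ t ∈ Icc t₁ T, subsystemField f p t (Z (T - t)) (v t) =
        -reversedField f p hJ (T - t) (Z (T - t)) (v t) := by
      intro t ht
      rw [reversedField_of_mem hJ (hmaps ht), sub_sub_cancel, neg_neg]
    refine Integrable.of_bound ?_ C ?_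
    · refine ((hcont.comp_aestronglyMeasurable
        ((by fun_prop : Continuous fun t : ℝ => T - t).aestronglyMeasurable.prodMk
          (hzm.prodMk hvm))).neg).congr ?_
      filter_upwards [ae_restrict_mem measurableSet_Icc] with t ht using (heq t ht).symm
    · filter_upwards [ae_restrict_mem measurableSet_Icc, hae] with t ht ⟨k, hk, hkt⟩
      rw [heq t ht, norm_neg]
      refine hC (T - t, Z (T - t), v t) ⟨hmaps ht, mem_closedBall_zero_iff.2 (hR t ht), ?_⟩
      rw [hv k t hkt]
      exact Finset.mem_coe.2 (Finset.mem_image_of_mem u (Finset.mem_range.2 hk))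
  refine ⟨hzc, hint, fun t ht => ?_⟩
  rw [integral_reflect]
  have hs := hmaps ht
  have hii : IntervalIntegrable (fun r => -subsystemField f p (T - r) (Z (T - (T - r))) (v (T - r)))
      volume 0 (T - t) :=
    intervalIntegrable_reflect (g := fun s => subsystemField f p s (Z (T - s)) (v s)) ht.2
      (hint.mono_set (Icc_subset_Icc_left ht.1))
  rw [intervalIntegral.integral_eq_sub_of_hasDeriv_right (f := Z)
    (hZc.mono (by rw [uIcc_of_le hs.1]; exact Icc_subset_Icc_right hs.2)) (fun r hr => ?_) hii,
    hZ0, add_sub_cancel]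
  rw [min_eq_left hs.1, max_eq_right hs.1] at hr
  obtain ⟨n, -, hn⟩ := exists_mem_Ico_succ (σ := σ) (t := r) (n := N) (hσ0 ▸ hr.1.le)
    (hσN ▸ hr.2.trans_le hs.2)
  have h := (hZ n r hn).mono Ioi_subset_Ici_self
  rw [reversedField_of_mem hJ ⟨hr.1.le, hr.2.le.trans hs.2⟩] at h
  rwa [sub_sub_cancel, hv n (T - r) ⟨by linarith [hn.2], by linarith [hn.1]⟩]

end Trajectory

/-! ### The reversed reference field and its comparison with the controlled field. -/

section Reference

variable {ν : ℕ} {m : ℕ → ℕ} {t₀ t₁ T : ℝ} {f : TriangularField m} {p : ℕ}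
variable {xs zs : (j : ℕ) → Block m j} {y : Blocks m (p + 1) → ℝ → Blocks m (p + 1)}

/-- The field of the first `p + 1` equations in reversed time, with the velocity of the last block
prescribed by the reference family. -/
noncomputable def reversedReferenceField (f : TriangularField m) (p : ℕ) (hJ : t₁ ≤ T)
    (y : Blocks m (p + 1) → ℝ → Blocks m (p + 1)) (ξ : Blocks m (p + 1)) (s : ℝ)
    (z : Blocks m (p + 1)) : Blocks m (p + 1) :=
  -prescribedField f p (projIcc t₁ T hJ (T - s))
    (derivWithin (fun r => y ξ r (Fin.last p)) (Icc t₁ T) (projIcc t₁ T hJ (T - s))) z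

theorem continuous_projIcc_sub (hJ : t₁ ≤ T) :
    Continuous fun s : ℝ => (projIcc t₁ T hJ (T - s) : ℝ) :=
  continuous_subtype_val.comp (continuous_projIcc.comp (by fun_prop))

theorem continuous_reversedReferenceField (hf : IsTriangularSystem ν m t₀ T f) (hp : p < ν)
    (ht : t₀ ≤ t₁) (hJ : t₁ < T) (hy : IsReferenceFamily f p t₁ T xs zs y) :
    Continuous fun q : Blocks m (p + 1) × ℝ × Blocks m (p + 1) =>
      reversedReferenceField f p hJ.le y q.1 q.2.1 q.2.2 := by
  have hr := continuous_reversedField hf hp ht hJ.le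
  have hg : Continuous fun q : Blocks m (p + 1) × ℝ × Blocks m (p + 1) =>
      (q.2.1, q.2.2, (0 : Block m (p + 1))) := by fun_prop
  have h1 := (hr.comp hg).neg
  have h2 := (hy.continuous_derivWithin_comp hJ (continuous_projIcc_sub hJ.le)
    fun s => (projIcc t₁ T hJ.le (T - s)).2).comp
      (by fun_prop : Continuous fun q : Blocks m (p + 1) × ℝ × Blocks m (p + 1) => (q.1, q.2.1))
  have h3 := (h1.update (Fin.last p) h2).neg
  refine h3.congr fun q => ?_
  simp only [Function.comp_apply, Pi.neg_apply, reversedField, neg_neg, reversedReferenceField,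
    prescribedField]

open Metric in
-- The last component does not depend on `z` and the others do not depend on `ξ`, so one constant
-- serves for all `ξ`.
theorem exists_lipschitzOnWith_reversedReferenceField (hf : IsTriangularSystem ν m t₀ T f)
    (hp : p < ν) (ht : t₀ ≤ t₁) (hJ : t₁ ≤ T) (R : ℝ) : ∃ K : NNReal, ∀ ξ s,
      LipschitzOnWith K (reversedReferenceField f p hJ y ξ s) (closedBall 0 R) := by
  obtain ⟨K, hK⟩ := exists_lipschitzOnWith_reversedField hf hp ht hJ (0 : Block m (p + 1)) R
  refine ⟨K, fun ξ s => LipschitzOnWith.of_dist_le_mul fun z hz z' hz' => ?_⟩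
  have h := (hK s).dist_le_mul z hz z' hz'
  rw [reversedField, reversedField, dist_neg_neg] at h
  rw [reversedReferenceField, reversedReferenceField, dist_neg_neg]
  refine (dist_pi_le_iff (by positivity)).2 fun i => ?_
  by_cases hi : i = Fin.last p
  · subst hi
    rw [prescribedField, prescribedField, Function.update_self, Function.update_self, dist_self]
    positivity
  · rw [prescribedField, prescribedField, Function.update_of_ne hi, Function.update_of_ne hi]
    exact (dist_le_pi_dist _ _ i).trans h

theorem norm_reversedField_sub (hJ : t₁ ≤ T) {s : ℝ} (hs : s ∈ Icc 0 (T - t₁))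
    (ξ z : Blocks m (p + 1)) (v : Block m (p + 1)) :
    ‖reversedField f p hJ s z v - reversedReferenceField f p hJ y ξ s z‖ =
      ‖(derivWithin (fun r => y ξ r (Fin.last p)) (Icc t₁ T) (T - s) : Block m p) -
        f p (T - s) z v‖ := by
  rw [reversedField, reversedReferenceField, ← norm_neg, projIcc_sub_of_mem hJ hs, neg_sub_neg,
    neg_sub, subsystemField_sub_prescribedField, Pi.norm_single, norm_sub_rev]

/-- Surjectivity of `f p` in the control is what permits exact steering at a point; freezing time
outside the interval makes it available for every real `s`. -/
theorem exists_reversedField_eq (hf : IsTriangularSystem ν m t₀ T f) (hp : p < ν)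
    (ht : t₀ ≤ t₁) (hJ : t₁ ≤ T) (ξ : Blocks m (p + 1)) (s : ℝ) (z : Blocks m (p + 1)) :
    ∃ v, reversedField f p hJ s z v = reversedReferenceField f p hJ y ξ s z := by
  obtain ⟨v, hv⟩ := hf.surjective p hp (projIcc t₁ T hJ (T - s))
    (Icc_subset_Icc_left ht (projIcc t₁ T hJ _).2) z
    (derivWithin (fun r => y ξ r (Fin.last p)) (Icc t₁ T) (projIcc t₁ T hJ (T - s)))
  refine ⟨v, ?_⟩
  rw [reversedField, reversedReferenceField, neg_inj, ← sub_eq_zero,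
    subsystemField_sub_prescribedField, hv, sub_self, Pi.single_zero]

theorem IsReferenceFamily.hasDerivWithinAt_reflect (hJ : t₁ ≤ T)
    (hy : IsReferenceFamily f p t₁ T xs zs y) (ξ : Blocks m (p + 1)) {s : ℝ}
    (hs : s ∈ Ico 0 (T - t₁)) :
    HasDerivWithinAt (fun r => y ξ (projIcc t₁ T hJ (T - r)))
      (reversedReferenceField f p hJ y ξ s (y ξ (projIcc t₁ T hJ (T - s)))) (Ici s) s := by
  have hs' : s ∈ Icc 0 (T - t₁) := ⟨hs.1, hs.2.le⟩
  have hmaps : MapsTo (fun r => T - r) (Icc 0 (T - t₁)) (Icc t₁ T) := fun r hr =>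
    ⟨by linarith [hr.2], by linarith [hr.1]⟩
  have h1 : HasDerivWithinAt (fun r => T - r) (-1) (Icc 0 (T - t₁)) s :=
    (hasDerivWithinAt_id s _).const_sub T
  have h2 := (hy.hasDerivWithinAt ξ (hmaps hs')).scomp s h1 hmaps
  rw [neg_one_smul] at h2
  rw [reversedReferenceField, projIcc_sub_of_mem hJ hs']
  refine (h2.congr (fun r hr => ?_) ?_).mono_of_mem_nhdsWithin
    (mem_of_superset (Icc_mem_nhdsGE hs.2) (Icc_subset_Icc_left hs.1))
  · rw [projIcc_sub_of_mem hJ hr]; rfl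
  · rw [projIcc_sub_of_mem hJ hs']; rfl

end Reference

/-! ### Assembly in the original time. -/

theorem lemma3p4 (ν : ℕ) (m : ℕ → ℕ) (t₀ t₁ T : ℝ) (ht₁ : t₁ ∈ Ioo t₀ T)
    (f : TriangularField m) (hf : IsTriangularSystem ν m t₀ T f)
    (xs zs : (j : ℕ) → Block m j) (hxz : IsRegularReference ν m t₁ f xs zs)
    (p : ℕ) (hp : p < ν)
    (y : Blocks m (p + 1) → ℝ → Blocks m (p + 1))
    (hy : IsReferenceFamily f p t₁ T xs zs y)
    (δ : Blocks m (p + 1) → ℝ) (hδ : Continuous δ) (hδ_pos : ∀ ξ, 0 < δ ξ) :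
    ∃ (M : Blocks m (p + 1) → ℝ) (v : Blocks m (p + 1) → ℝ → Block m (p + 1)),
      Continuous M ∧ (∀ ξ, 0 < M ξ) ∧
      (∀ ξ, IsPiecewiseConstantOn (v ξ) t₁ T) ∧
      (∃ hv : ∀ ξ, MemLp (v ξ) 1 (volume.restrict (Icc t₁ T)),
        Continuous fun ξ => (hv ξ).toLp (v ξ)) ∧
      (∀ ξ, (∃ z, IsTrajectoryOn f p t₁ T T ξ (v ξ) z) ∧
        ∀ z, IsTrajectoryOn f p t₁ T T ξ (v ξ) z → ∀ t ∈ Icc t₁ T,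
          ‖(derivWithin (fun s => y ξ s (Fin.last p)) (Icc t₁ T) t : Block m p) -
            f p t (z t) (v ξ t)‖ < δ ξ) ∧
      (∀ ξ, eLpNorm (v ξ) ⊤ (volume.restrict (Icc t₁ T)) ≤ ENNReal.ofReal (M ξ)) := by
  have ht : t₀ ≤ t₁ := ht₁.1.le
  have hJ : t₁ ≤ T := ht₁.2.le
  have hFc : ∀ u : Block m (p + 1), Continuous fun q : ℝ × Blocks m (p + 1) =>
      reversedField f p hJ q.1 q.2 u := by
    intro u
    have h := (continuous_reversedField hf hp ht hJ).comp
      (by fun_prop : Continuous fun q : ℝ × Blocks m (p + 1) => (q.1, q.2, u))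
    exact h
  have hFlip := exists_lipschitzOnWith_reversedField hf hp ht hJ
  obtain ⟨σ, u, hσc, hσ0, hσ, hσb, hσN, hZ⟩ := exists_steering (b := T - t₁) (sub_nonneg.2 hJ)
    hFc hFlip (continuous_reversedReferenceField hf hp ht ht₁.2 hy)
    (exists_lipschitzOnWith_reversedReferenceField hf hp ht hJ)
    (exists_reversedField_eq hf hp ht hJ)
    (hy.continuous_comp (continuous_projIcc_sub hJ) fun s => (projIcc t₁ T hJ (T - s)).2)
    (fun ξ s hs => hy.hasDerivWithinAt_reflect hJ ξ hs) hδ hδ_pos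
  choose Z hZc hZ0 hZ using hZ
  have hanti : ∀ ξ, Antitone fun n => T - σ n ξ := fun ξ i j hij => sub_le_sub_left (hσ ξ hij) T
  have hτ0 : ∀ ξ, T - σ 0 ξ = T := fun ξ => by rw [hσ0, sub_zero]
  have hN : ∀ ξ, ∃ N, σ N ξ = T - t₁ := fun ξ =>
    let ⟨N, h⟩ := hσN ξ
    ⟨N, h.self_of_nhds⟩
  -- The switching intervals `Ioc` leave out `t₁`, yet the estimate is required there too. The value
  -- at this one point is chosen to make the error zero; it affects neither `L₁` nor `L_∞`.
  choose c hc using fun ξ => hf.surjective p hp t₁ ⟨ht, hJ⟩ (Z ξ (T - t₁))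
    (derivWithin (fun s => y ξ s (Fin.last p)) (Icc t₁ T) t₁)
  choose v hv hvc using fun ξ => exists_switching_control (hanti ξ) u (c ξ)
  have hZstart : ∀ ξ, Z ξ 0 = ξ := fun ξ => by
    rw [hZ0, projIcc_sub_of_mem hJ ⟨le_rfl, sub_nonneg.2 hJ⟩, sub_zero, hy.terminal]
  -- Only values used on a nonempty interval need a bound, so near `ξ₀` the first `N` of them
  -- suffice. The admissible bounds form an upward closed set of reals, hence a convex one.
  obtain ⟨M, hM⟩ : ∃ M : C(Blocks m (p + 1), ℝ), ∀ ξ, M ξ ∈ {M : ℝ | 0 < M ∧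
      ∀ n, σ n ξ < σ (n + 1) ξ → ‖u n‖ ≤ M} := by
    refine exists_continuous_forall_mem_convex_of_local_const (fun ξ => OrdConnected.convex ⟨?_⟩)
      fun ξ₀ => ?_
    · rintro a ⟨ha, ha'⟩ _ - x ⟨hx, -⟩
      exact ⟨ha.trans_le hx, fun n hn => (ha' n hn).trans hx⟩
    · obtain ⟨N, hN⟩ := hσN ξ₀
      refine ⟨∑ n ∈ Finset.range N, ‖u n‖ + 1, ?_⟩
      filter_upwards [hN] with ξ hξ
      refine ⟨by positivity, fun n hn => ?_⟩
      have hnN : n < N := by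
        by_contra h
        exact absurd ((hσb (n + 1) ξ).trans (hξ ▸ hσ ξ (not_lt.1 h))) (not_le.2 hn)
      linarith [Finset.single_le_sum (f := fun n => ‖u n‖) (fun n _ => norm_nonneg (u n))
        (Finset.mem_range.2 hnN)]
  have hmem : ∀ ξ, MemLp (v ξ) 1 (volume.restrict (Icc t₁ T)) := by
    intro ξ
    obtain ⟨N, hN⟩ := hN ξ
    have h := memLp_of_switching (a := t₁) (hanti ξ) (hv ξ) (N := N) (by rw [hN]; ring) 1
    rwa [hτ0] at h
  refine ⟨M, v, M.continuous, fun ξ => (hM ξ).1, fun ξ => ?_, ⟨hmem, ?_⟩, fun ξ => ⟨?_, ?_⟩,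
    fun ξ => ?_⟩
  · obtain ⟨N, hN⟩ := hN ξ
    have h := isPiecewiseConstantOn_of_switching (hanti ξ) (hv ξ) N
    rwa [hτ0, hN, sub_sub_cancel] at h
  · refine continuous_toLp_of_switching (τ := fun n ξ => T - σ n ξ) hanti
      (fun n => continuous_const.sub (hσc n)) hτ0 (fun ξ₀ => ?_) hv hmem
    obtain ⟨N, hN⟩ := hσN ξ₀
    exact ⟨N, hN.mono fun ξ h => by rw [h, sub_sub_cancel]⟩
  · obtain ⟨N, hN⟩ := hN ξ
    exact ⟨_, isTrajectoryOn_of_switching hf hp ht hJ (hσ ξ) (hσ0 ξ) hN (hv ξ) (hZc ξ) (hZstart ξ)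
      fun n s hs => (hZ ξ n s hs).1⟩
  · intro z hz t htJ
    obtain ⟨N, hN⟩ := hN ξ
    have hmaps : MapsTo (fun r => T - r) (Icc 0 (T - t₁)) (Icc t₁ T) := fun r hr =>
      ⟨by linarith [hr.2], by linarith [hr.1]⟩
    have hzT : z T = ξ := by
      have h := hz.integral_eq T ⟨hJ, le_rfl⟩
      rwa [intervalIntegral.integral_same, add_zero] at h
    -- An arbitrary trajectory for this control coincides with the constructed one, for which the
    -- error is known.
    have heq := eqOn_of_switching hFlip (hσ ξ) (hσ0 ξ) (fun n => hσb n ξ) (hZc ξ)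
      (hz.continuousOn.comp (by fun_prop) hmaps) (by simp [hZstart, hzT])
      (fun n s hs => (hZ ξ n s hs).1)
      (hz.hasDerivWithinAt_reflect hf hp ht hJ (hσ ξ) (hσ0 ξ) (fun n => hσb n ξ) (hv ξ)) N
    have hst : T - t ∈ Icc 0 (T - t₁) := ⟨by linarith [htJ.2], by linarith [htJ.1]⟩
    have hzt : z t = Z ξ (T - t) := by
      have h := heq (hN ▸ hst)
      simp only [Function.comp_apply, sub_sub_cancel] at h
      exact h.symm
    rw [hzt]
    rcases htJ.1.eq_or_lt with rfl | hlt
    · rw [hvc ξ t₁ fun n hn => absurd (hσb (n + 1) ξ) (by linarith [hn.1]), hc, sub_self, norm_zero]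
      exact hδ_pos ξ
    · obtain ⟨n, -, hn⟩ := exists_mem_Ioc_succ (τ := fun n => T - σ n ξ) (t := t) (n := N)
        (by rw [hτ0]; exact htJ.2) (by rw [hN, sub_sub_cancel]; exact hlt)
      rw [hv ξ n t hn]
      have hne : T - t ∈ Ico (σ n ξ) (σ (n + 1) ξ) := ⟨by linarith [hn.2], by linarith [hn.1]⟩
      have h := (hZ ξ n _ hne).2
      rw [norm_reversedField_sub hJ hst] at h
      rwa [sub_sub_cancel] at h
  · obtain ⟨N, hN⟩ := hN ξ
    have h := eLpNorm_top_le_of_switching (a := t₁) (τ := fun n => T - σ n ξ) (N := N) (by rw [hN]; ring) (hv ξ)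
      (M := M ξ) fun n hn => (hM ξ).2 n (by linarith)
    rwa [hτ0] at h
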